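/- Let $\mathbb D$ be the open unit disk, $\mathbb T=\partial\mathbb D$, and $d(z)=\operatorname{dist}(z,\mathbb T)$. A continuous increasing function $\omega:[0,\infty)\to[0,\infty)$ with $\omega(0)=0$ and $\omega(t)/t$ non-increasing on $(0,\infty)$ is called a majorant; it is fast if there are $\delta_0>0$ and $M>0$ with $\int_0^\delta \omega(t)\,\frac{dt}{t}\le M\omega(\delta)$ for $0<\delta<\delta_0$. For $p\in[1,\infty]$ and a Borel function $F:\overline{\mathbb D}\to\mathbb C$ put $\mathcal L_p[F](z_1,z_2)=\big(\int_0^{2\pi}|F(e^{i\eta}z_1)-F(e^{i\eta}z_2)|^p\,d\eta\big)^{1/p}$ if $p<\infty$ and $\mathcal L_\infty[F](z_1,z_2)=|F(z_1)-F(z_2)|$. Write $F\in\Lambda_{\omega,p}(\overline{\mathbb D})$ if there is $M>0$ with $\mathcal L_p[F](z_1,z_2)\le M\omega(|z_1-z_2|)$ for all $z_1,z_2\in\overline{\mathbb D}$. Let $\mathscr M_F=|F_z|+|F_{\bar z}|$ and $J_F=|F_z|^2-|F_{\bar z}|^2$, where $F_z=\frac12(F_x-iF_y)$ and $F_{\bar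 z}=\frac12(F_x+iF_y)$. A continuous sense-preserving map $F:\mathbb D\to\mathbb C$ is $K$-quasiregular if it is absolutely continuous on lines with locally square-integrable partial derivatives, $J_F>0$ a.e., and $\mathscr M_F^2\le KJ_F$ a.e. in $\mathbb D$. For $0<q<\infty$ and $D_z=\{\xi:|\xi-z|<d(z)/2\}$, with area $|D_z|$, put $$\mathscr Y_{F,q,p}(z)=\Big(\int_0^{2\pi}\Big(\frac1{|D_z|}\int_{D_z}\mathscr M_F(\xi e^{i\eta})^q\,dA(\xi)\Big)^{p/q}d\eta\Big)^{1/p}\ (p<\infty),\qquad \mathscr Y_{F,q,\infty}(z)=\Big(\frac1{|D_z|}\int_{D_z}\mathscr M_F(\xi)^q\,dA(\xi)\Big)^{1/q}.$$ **Theorem.** Let $p\in[1,\infty]$, let $\omega$ be a fast majorant, and let $f=u+iv=h+\overline g$ be a complex-valued harmonic function in $\mathbb D$, continuous on $\overline{\mathbb D}$, where $u,v$ are real-valued and $h,g$ are analytic in $\mathbb D$ and continuous on $\overline{\mathbb D}$. Then the following are equivalent. 1. There is $M>0$ such that for all $z\in\mathbb D$: $\big(\int_0^{2\pi}\mathscr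 M_f(ze^{i\eta})^p\,d\eta\big)^{1/p}\le M\,\omega(d(z))/d(z)$ if $p<\infty$, respectively $\mathscr M_f(z)\le M\,\omega(d(z))/d(z)$ if $p=\infty$. 2. $f\in\Lambda_{\omega,p}(\overline{\mathbb D})$. 3. $h\in\Lambda_{\omega,p}(\overline{\mathbb D})$ and $g\in\Lambda_{\omega,p}(\overline{\mathbb D})$. 4. $|h|\in\Lambda_{\omega,p}(\overline{\mathbb D})$ and $|g|\in\Lambda_{\omega,p}(\overline{\mathbb D})$. If moreover $f$ is $K$-quasiregular in $\mathbb D$ for some $K\in[1,\infty)$, then for every real $q$ with $0<q\le p$ (that is, $0<q\le p<\infty$ or $0<q<p=\infty$) conditions 1–4 are equivalent to each of the following. 5. $|f|\in\Lambda_{\omega,p}(\overline{\mathbb D})$. 6. $u\in\Lambda_{\omega,p}(\overline{\mathbb D})$. 7. $|u|\in\Lambda_{\omega,p}(\overline{\mathbb D})$. 8. $v\in\Lambda_{\omega,p}(\overline{\mathbb D})$. 9. $|v|\in\Lambda_{\omega,p}(\overline{\mathbb D})$. 10. There is $M>0$ such that $\mathscr Y_{u,q,p}(z)\le M\,\omega(d(z))/d(z)$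 for all $z\in\mathbb D$. 11. There is $M>0$ such that $\mathscr Y_{v,q,p}(z)\le M\,\omega(d(z))/d(z)$ for all $z\in\mathbb D$. -/

import Mathlib

open Set Metric MeasureTheory InnerProductSpace
open scoped ENNReal ComplexConjugate

noncomputable section

namespace HardyLittlewood

/-- A majorant: a continuous increasing function `ω : [0, ∞) → [0, ∞)` with `ω 0 = 0` such that
`ω t / t` is non-increasing on `(0, ∞)`. Only the values of `ω` on `[0, ∞)` matter. -/
structure IsMajorant (ω : ℝ → ℝ) : Prop where
  continuousOn : ContinuousOn ω (Ici 0)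
  monotoneOn : MonotoneOn ω (Ici 0)
  map_zero : ω 0 = 0
  antitoneOn_div : AntitoneOn (fun t => ω t / t) (Ioi 0)

/-- A fast majorant: `∫₀^δ ω(t)/t dt ≤ M ω(δ)` for all `0 < δ < δ₀`, with some positive constants
`δ₀` and `M`. The integral is that of a nonnegative function, so the bound includes its
finiteness. -/
structure IsFastMajorant (ω : ℝ → ℝ) : Prop extends IsMajorant ω where
  exists_integral_le : ∃ δ₀ > (0 : ℝ), ∃ M > (0 : ℝ), ∀ δ ∈ Ioo 0 δ₀,
    ∫⁻ t in Ioo 0 δ, ENNReal.ofReal (ω t / t) ≤ ENNReal.ofReal (M * ω δ)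

/-- The open unit disk. -/
def unitDisk : Set ℂ := ball 0 1

/-- The closed unit disk. -/
def closedUnitDisk : Set ℂ := closedBall 0 1

/-- The distance from `z` to the boundary of the unit disk. -/
def bdryDist (z : ℂ) : ℝ := infDist z (frontier unitDisk)

/-- The point `e^{iη}` of the unit circle. -/
def rot (η : ℝ) : ℂ := Complex.exp (η * Complex.I)

/-- The formal derivative `f_z = (f_x - i f_y) / 2`, through the two partial derivatives. -/
def dz (f : ℂ → ℂ) (z : ℂ) : ℂ :=
  (lineDeriv ℝ f z 1 - Complex.I * lineDeriv ℝ f z Complex.I) / 2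

/-- The formal derivative `f_z̄ = (f_x + i f_y) / 2`, through the two partial derivatives. -/
def dzbar (f : ℂ → ℂ) (z : ℂ) : ℂ :=
  (lineDeriv ℝ f z 1 + Complex.I * lineDeriv ℝ f z Complex.I) / 2

/-- `M_f(z) = |f_z(z)| + |f_z̄(z)|`. -/
def maxDeriv (f : ℂ → ℂ) (z : ℂ) : ℝ := ‖dz f z‖ + ‖dzbar f z‖

/-- The Jacobian `J_f(z) = |f_z(z)|² - |f_z̄(z)|²`. -/
def jacobian (f : ℂ → ℂ) (z : ℂ) : ℝ := ‖dz f z‖ ^ 2 - ‖dzbar f z‖ ^ 2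

/-- `f` is absolutely continuous on lines in `Ω`: for every closed rectangle
`[a, b] × [c, d] ⊆ Ω`, `f` is absolutely continuous on almost every horizontal and almost every
vertical line of the rectangle. -/
def IsACL (f : ℂ → ℂ) (Ω : Set ℂ) : Prop :=
  ∀ a b c d : ℝ, a ≤ b → c ≤ d → Icc a b ×ℂ Icc c d ⊆ Ω →
    (∀ᵐ y ∂(volume.restrict (Icc c d)),
      AbsolutelyContinuousOnInterval (fun x : ℝ => f ⟨x, y⟩) a b) ∧
    (∀ᵐ x ∂(volume.restrict (Icc a b)),
      AbsolutelyContinuousOnInterval (fun y : ℝ => f ⟨x, y⟩) c d)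

/-- `f` is `ACL²` in `Ω`: it is `ACL` and its partial derivatives are locally square integrable. -/
def IsACL2 (f : ℂ → ℂ) (Ω : Set ℂ) : Prop :=
  IsACL f Ω ∧ ∀ C : Set ℂ, IsCompact C → C ⊆ Ω →
    MemLp (fun z => lineDeriv ℝ f z 1) 2 (volume.restrict C) ∧
    MemLp (fun z => lineDeriv ℝ f z Complex.I) 2 (volume.restrict C)

/-- `f` is `K`-quasiregular in `Ω`: continuous and `ACL²`, with `J_f > 0` and `M_f² ≤ K J_f`
almost everywhere. A continuous `ACL²` map with `J_f > 0` almost everywhere is automatically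
sense-preserving, so this is not listed separately. -/
structure IsQuasiregularOn (K : ℝ) (f : ℂ → ℂ) (Ω : Set ℂ) : Prop where
  one_le : 1 ≤ K
  continuousOn : ContinuousOn f Ω
  acl2 : IsACL2 f Ω
  jacobian_pos : ∀ᵐ z ∂(volume.restrict Ω), 0 < jacobian f z
  dilatation_le : ∀ᵐ z ∂(volume.restrict Ω), maxDeriv f z ^ 2 ≤ K * jacobian f z

/-- `(∫₀^{2π} F(η)^p dη)^{1/p}` for a finite exponent `p`. -/
def angularNorm (p : ℝ) (F : ℝ → ℝ≥0∞) : ℝ≥0∞ :=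
  (∫⁻ η in Ioo 0 (2 * Real.pi), F η ^ p) ^ (1 / p)

/-- `L_p[f](z₁, z₂)`: the `L^p` mean over `η ∈ (0, 2π)` of `|f(e^{iη} z₁) - f(e^{iη} z₂)|` if
`p < ∞`, and `|f(z₁) - f(z₂)|` if `p = ∞`. -/
def lipMean (p : ℝ≥0∞) (f : ℂ → ℂ) (z₁ z₂ : ℂ) : ℝ≥0∞ :=
  if p = ∞ then ‖f z₁ - f z₂‖ₑ
  else angularNorm p.toReal fun η => ‖f (rot η * z₁) - f (rot η * z₂)‖ₑ

/-- Membership in `Λ_{ω,p}` of the closed unit disk. -/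
def MemLipschitz (ω : ℝ → ℝ) (p : ℝ≥0∞) (f : ℂ → ℂ) : Prop :=
  (Measurable fun z : closedUnitDisk => f z) ∧
  ∃ M > (0 : ℝ), ∀ z₁ ∈ closedUnitDisk, ∀ z₂ ∈ closedUnitDisk,
    lipMean p f z₁ z₂ ≤ ENNReal.ofReal (M * ω ‖z₁ - z₂‖)

/-- The integral mean of `M_f` at `z`: `(∫₀^{2π} M_f(z e^{iη})^p dη)^{1/p}` if `p < ∞`, and
`M_f(z)` if `p = ∞`. -/
def derivMean (p : ℝ≥0∞) (f : ℂ → ℂ) (z : ℂ) : ℝ≥0∞ :=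
  if p = ∞ then ENNReal.ofReal (maxDeriv f z)
  else angularNorm p.toReal fun η => ENNReal.ofReal (maxDeriv f (z * rot η))

/-- The average over the disk `D(z, d(z)/2)` of `ξ ↦ M_f(ξ e^{iη})^q`. -/
def localAverage (q : ℝ) (f : ℂ → ℂ) (z : ℂ) (η : ℝ) : ℝ≥0∞ :=
  (∫⁻ ξ in ball z (bdryDist z / 2), ENNReal.ofReal (maxDeriv f (ξ * rot η)) ^ q) /
    volume (ball z (bdryDist z / 2))

/-- The local area average `Y_{f,q,p}(z)`:
`(∫₀^{2π} (average over D(z, d(z)/2) of M_f(ξ e^{iη})^q)^{p/q} dη)^{1/p}` if `p < ∞`, and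
`(average over D(z, d(z)/2) of M_f(ξ)^q)^{1/q}` if `p = ∞`. -/
def areaMean (q : ℝ) (p : ℝ≥0∞) (f : ℂ → ℂ) (z : ℂ) : ℝ≥0∞ :=
  if p = ∞ then localAverage q f z 0 ^ (1 / q)
  else (∫⁻ η in Ioo 0 (2 * Real.pi), localAverage q f z η ^ (p.toReal / q)) ^ (1 / p.toReal)

/-- A quantity `Q` on the unit disk is bounded by `M ω(d(z)) / d(z)` for some constant `M > 0`. -/
def GrowthBound (ω : ℝ → ℝ) (Q : ℂ → ℝ≥0∞) : Prop :=
  ∃ M > (0 : ℝ), ∀ z ∈ unitDisk, Q z ≤ ENNReal.ofReal (M * (ω (bdryDist z) / bdryDist z))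

/-- The modulus `|f|`, as a complex-valued function. -/
def modulus (f : ℂ → ℂ) (z : ℂ) : ℂ := (‖f z‖ : ℝ)

/-- The real part `u` of `f`, as a complex-valued function. -/
def rePart (f : ℂ → ℂ) (z : ℂ) : ℂ := ((f z).re : ℝ)

/-- The imaginary part `v` of `f`, as a complex-valued function. -/
def imPart (f : ℂ → ℂ) (z : ℂ) : ℂ := ((f z).im : ℝ)

end HardyLittlewood

end

open HardyLittlewood

open HardyLittlewood

namespace HardyLittlewood

open Filter Topology Real

/-! ### Minkowski's integral inequality -/

/-! For `f = h + conj g` the quantity `M_f` is `|h'| + |g'|`, and every condition is compared with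
its growth. From growth to smoothness, `f` is integrated along a path that goes radially inward by
`d = min δ δ₁`, across a segment, and back out. Fastness bounds the radial pieces, and monotonicity
of `ω(t)/t` bounds the segment. In the other direction, the kernel `k = 2 + 2 Re(l r/(ζ - z))` on
`|ζ - z| = r`, with `|l| = 1`, lies in `[0, 4]` and has mean 2. Averaging `k Re(conj c * f)` against
it, where `c` is the direction of `f z`, produces `2|f z| + r|conj c * h' + c * g'|` for a suitable
`l`. Since `Re(conj c * f) ≤ |f|`, the oscillation of the modulus alone controls `|conj c * h' + c *
g'|` (`mul_norm_le_circleAverage`). This is all of `M_f` when `f` is holomorphic or real, and at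
least `M_f / K` when `f` is quasiregular, because then `|h'| + |g'| ≤ K(|h'| - |g'|)`. The same
inequality bounds `M_f` by `K|h' + g'|` and `K|h' - g'|`, which are `K` times `M_u` and `M_v`.
Minkowski's integral inequality carries these pointwise estimates to means over rotations. The area
means are handled by subharmonicity of `|h' ± g'|^q` in one direction and by Minkowski with exponent
`s / q ≥ 1` in the other, where `s = p` for finite `p`. -/

theorem lintegral_rpow_le_of_weight {α : Type*} [MeasurableSpace α] (μ : Measure α) {s : ℝ}
    (hs : 1 ≤ s) {φ w : α → ℝ≥0∞} (hφ : AEMeasurable φ μ) (hw : AEMeasurable w μ)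
    (hw0 : ∀ᵐ t ∂μ, w t ≠ 0) (hw1 : ∀ᵐ t ∂μ, w t ≠ ∞) :
    (∫⁻ t, φ t ∂μ) ^ s ≤ (∫⁻ t, w t ∂μ) ^ (s - 1) * ∫⁻ t, φ t ^ s * w t ^ (1 - s) ∂μ := by
  rcases hs.eq_or_lt with rfl | hs
  · simp
  have hconj : s.HolderConjugate (s / (s - 1)) := Real.HolderConjugate.conjExponent hs
  have hs0 : 0 < s := by linarith
  have hs1 : 0 < s - 1 := by linarith
  -- Hölder for the factorisation of `φ` into `φ w^(-(s-1)/s)` and `w^((s-1)/s)`.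
  have key := ENNReal.lintegral_mul_le_Lp_mul_Lq μ hconj
    (f := fun t => φ t * w t ^ (-((s - 1) / s))) (g := fun t => w t ^ ((s - 1) / s))
    (hφ.mul (hw.pow_const _)) (hw.pow_const _)
  have e1 : ∫⁻ t, φ t ∂μ = ∫⁻ a, ((fun t => φ t * w t ^ (-((s - 1) / s))) *
      fun t => w t ^ ((s - 1) / s)) a ∂μ := by
    refine lintegral_congr_ae ?_
    filter_upwards [hw0, hw1] with t h0 h1
    simp only [Pi.mul_apply]
    rw [mul_assoc, ← ENNReal.rpow_add _ _ h0 h1]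
    simp
  have e2 : ∀ t, (φ t * w t ^ (-((s - 1) / s))) ^ s = φ t ^ s * w t ^ (1 - s) := by
    intro t
    rw [ENNReal.mul_rpow_of_nonneg _ _ hs0.le, ← ENNReal.rpow_mul]
    congr 2
    field_simp
    ring
  have e3 : ∀ t, (w t ^ ((s - 1) / s)) ^ (s / (s - 1)) = w t := by
    intro t
    rw [← ENNReal.rpow_mul]
    have : (s - 1) / s * (s / (s - 1)) = 1 := by field_simp
    rw [this, ENNReal.rpow_one]
  simp only [e2, e3] at key
  rw [e1]
  refine (ENNReal.rpow_le_rpow key hs0.le).trans_eq ?_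
  rw [ENNReal.mul_rpow_of_nonneg _ _ hs0.le, ← ENNReal.rpow_mul, ← ENNReal.rpow_mul, mul_comm]
  congr 1
  · congr 1
    field_simp
  · rw [one_div_mul_cancel hs0.ne', ENNReal.rpow_one]

/-- The bound `w` itself serves as the Hölder weight: after Tonelli the inner integral is at most
`w^s * w^(1-s) = w`. Nothing is divided by the left-hand side, so its finiteness need not be known
in advance. -/
theorem minkowski_of_weight_pos {α β : Type*} [MeasurableSpace α] [MeasurableSpace β]
    (μ : Measure α) [SFinite μ] (ν : Measure β) [SFinite ν] {s : ℝ} (hs : 1 ≤ s)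
    {φ : α → β → ℝ≥0∞} (hφ : Measurable (Function.uncurry φ)) {w : α → ℝ≥0∞}
    (hw : AEMeasurable w μ) (hw0 : ∀ᵐ t ∂μ, w t ≠ 0) (hw1 : ∀ᵐ t ∂μ, w t ≠ ∞)
    (hφw : ∀ᵐ t ∂μ, (∫⁻ η, φ t η ^ s ∂ν) ^ (1 / s) ≤ w t) :
    (∫⁻ η, (∫⁻ t, φ t η ∂μ) ^ s ∂ν) ^ (1 / s) ≤ ∫⁻ t, w t ∂μ := by
  have hs0 : 0 < s := by linarith
  rw [one_div, ENNReal.rpow_inv_le_iff hs0]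
  have hφ1 : ∀ η, Measurable fun t => φ t η := fun η => hφ.comp (measurable_id.prodMk measurable_const)
  have hφ2 : ∀ t, Measurable fun η => φ t η := fun t => hφ.comp (measurable_const.prodMk measurable_id)
  obtain ⟨v, hv, hwv⟩ := hw
  calc ∫⁻ η, (∫⁻ t, φ t η ∂μ) ^ s ∂ν
      ≤ ∫⁻ η, (∫⁻ t, v t ∂μ) ^ (s - 1) * ∫⁻ t, φ t η ^ s * v t ^ (1 - s) ∂μ ∂ν := by
        refine lintegral_mono fun η => lintegral_rpow_le_of_weight μ hs (hφ1 η).aemeasurable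
          hv.aemeasurable ?_ ?_
        · filter_upwards [hwv, hw0] with t h1 h2 using h1 ▸ h2
        · filter_upwards [hwv, hw1] with t h1 h2 using h1 ▸ h2
    _ = (∫⁻ t, v t ∂μ) ^ (s - 1) * ∫⁻ η, ∫⁻ t, φ t η ^ s * v t ^ (1 - s) ∂μ ∂ν := by
        refine lintegral_const_mul _ (Measurable.lintegral_prod_right' (f := fun x : β × α =>
          φ x.2 x.1 ^ s * v x.2 ^ (1 - s)) ?_)
        exact ((hφ.comp measurable_swap).pow_const s).mul ((hv.comp measurable_snd).pow_const _)
    _ = (∫⁻ t, v t ∂μ) ^ (s - 1) * ∫⁻ t, ∫⁻ η, φ t η ^ s * v t ^ (1 - s) ∂ν ∂μ := by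
        rw [lintegral_lintegral_swap]
        exact (((hφ.comp measurable_swap).pow_const s).mul
          ((hv.comp measurable_snd).pow_const _)).aemeasurable
    _ ≤ (∫⁻ t, v t ∂μ) ^ (s - 1) * ∫⁻ t, v t ∂μ := by
        refine mul_le_mul' le_rfl ?_
        refine lintegral_mono_ae ?_
        filter_upwards [hwv, hw0, hw1, hφw] with t h1 h2 h3 h4
        rw [lintegral_mul_const _ ((hφ2 t).pow_const s), ← h1]
        rw [one_div, ENNReal.rpow_inv_le_iff hs0] at h4
        calc (∫⁻ η, φ t η ^ s ∂ν) * w t ^ (1 - s) ≤ w t ^ s * w t ^ (1 - s) := by gcongr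
          _ = w t := by rw [← ENNReal.rpow_add _ _ h2 h3]; simp
    _ = (∫⁻ t, v t ∂μ) ^ s := by
        rcases hs.eq_or_lt with rfl | hs
        · simp
        conv_lhs => enter [2]; rw [← ENNReal.rpow_one (∫⁻ t, v t ∂μ)]
        rw [← ENNReal.rpow_add_of_nonneg _ _ (by linarith) zero_le_one]
        simp
    _ = (∫⁻ t, w t ∂μ) ^ s := by rw [lintegral_congr_ae hwv]

/-- Minkowski's integral inequality. -/
theorem minkowski {α β : Type*} [MeasurableSpace α] [MeasurableSpace β]
    (μ : Measure α) [IsFiniteMeasure μ] (ν : Measure β) [SFinite ν] {s : ℝ} (hs : 1 ≤ s)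
    {φ : α → β → ℝ≥0∞} (hφ : Measurable (Function.uncurry φ)) {w : α → ℝ≥0∞}
    (hw : AEMeasurable w μ) (hw1 : ∀ᵐ t ∂μ, w t ≠ ∞)
    (hφw : ∀ᵐ t ∂μ, (∫⁻ η, φ t η ^ s ∂ν) ^ (1 / s) ≤ w t) :
    (∫⁻ η, (∫⁻ t, φ t η ∂μ) ^ s ∂ν) ^ (1 / s) ≤ ∫⁻ t, w t ∂μ := by
  -- A weight that may vanish is replaced by `w + 1/n`; finiteness of `μ` makes the error tend to
  -- zero. At `n = 0` the inverse is `∞`.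
  have key : ∀ n : ℕ, (∫⁻ η, (∫⁻ t, φ t η ∂μ) ^ s ∂ν) ^ (1 / s) ≤
      ∫⁻ t, w t ∂μ + (n : ℝ≥0∞)⁻¹ * μ univ := by
    intro n
    rcases Nat.eq_zero_or_pos n with rfl | hn
    · by_cases hμ : μ univ = 0
      · have : μ = 0 := Measure.measure_univ_eq_zero.1 hμ
        subst this
        simp [ENNReal.zero_rpow_of_pos, show 0 < s by linarith]
      · simp [ENNReal.top_mul hμ]
    have hn0 : (n : ℝ≥0∞)⁻¹ ≠ 0 := by simp
    have hn1 : (n : ℝ≥0∞)⁻¹ ≠ ∞ := by simpa using hn.ne'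
    refine (minkowski_of_weight_pos μ ν hs hφ (w := fun t => w t + (n : ℝ≥0∞)⁻¹)
      (hw.add_const _) ?_ ?_ ?_).trans_eq ?_
    · exact .of_forall fun t h => hn0 (add_eq_zero.1 h).2
    · filter_upwards [hw1] with t ht using ENNReal.add_ne_top.2 ⟨ht, hn1⟩
    · filter_upwards [hφw] with t ht using ht.trans le_self_add
    · rw [lintegral_add_right _ measurable_const, lintegral_const]
  have hlim : Tendsto (fun n : ℕ => ∫⁻ t, w t ∂μ + (n : ℝ≥0∞)⁻¹ * μ univ) atTop
      (𝓝 (∫⁻ t, w t ∂μ + 0 * μ univ)) :=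
    tendsto_const_nhds.add (ENNReal.Tendsto.mul_const ENNReal.tendsto_inv_nat_nhds_zero
      (.inr (measure_ne_top _ _)))
  simpa using ge_of_tendsto' hlim key

/-! ### The mean over rotations, for all exponents at once -/

/-- The `L^p` mean over rotations, which is the value at the angle `0` if `p = ∞`. -/
noncomputable def rotNorm (p : ℝ≥0∞) (F : ℝ → ℝ≥0∞) : ℝ≥0∞ :=
  if p = ∞ then F 0 else angularNorm p.toReal F

/-- For `p = ∞` the Dirac mass at `0` turns every exponent into evaluation at `0`, so `s = max 1 q`
is a free choice that secures `q ≤ s`. Finite and infinite `p` can then be treated together. -/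
theorem exists_measure_rotNorm {p : ℝ≥0∞} (hp : 1 ≤ p) {q : ℝ} (hqp : ENNReal.ofReal q ≤ p) :
    ∃ (ν : Measure ℝ) (s : ℝ), IsFiniteMeasure ν ∧ 1 ≤ s ∧ q ≤ s ∧
      ∀ F : ℝ → ℝ≥0∞, rotNorm p F = (∫⁻ η, F η ^ s ∂ν) ^ (1 / s) := by
  by_cases h : p = ∞
  · refine ⟨Measure.dirac 0, max 1 q, inferInstance, le_max_left _ _, le_max_right _ _, fun F => ?_⟩
    have : max 1 q ≠ 0 := (lt_of_lt_of_le one_pos (le_max_left 1 q)).ne'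
    rw [lintegral_dirac, ← ENNReal.rpow_mul, mul_one_div_cancel this]
    simp [rotNorm, h]
  · refine ⟨volume.restrict (Ioo 0 (2 * π)), p.toReal, inferInstance, ?_, ?_, fun F => ?_⟩
    · simpa using ENNReal.toReal_mono h hp
    · exact (ENNReal.ofReal_le_iff_le_toReal h).1 hqp
    · simp [rotNorm, h, angularNorm]

theorem rotNorm_mono {p : ℝ≥0∞} {F G : ℝ → ℝ≥0∞} (h : ∀ η, F η ≤ G η) :
    rotNorm p F ≤ rotNorm p G := by
  unfold rotNorm angularNorm
  split_ifs
  · exact h 0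
  · gcongr
    exact h _

theorem rotNorm_const_mul {p : ℝ≥0∞} (hp : 1 ≤ p) {c : ℝ≥0∞} (hc : c ≠ ∞) (F : ℝ → ℝ≥0∞) :
    rotNorm p (fun η => c * F η) = c * rotNorm p F := by
  obtain ⟨ν, s, _, hs, -, h⟩ := exists_measure_rotNorm hp (q := 1) (by simpa using hp)
  have hs0 : 0 < s := by linarith
  rw [h, h]
  simp_rw [ENNReal.mul_rpow_of_nonneg _ _ hs0.le]
  rw [lintegral_const_mul' _ _ (ENNReal.rpow_ne_top_of_nonneg hs0.le hc),
    ENNReal.mul_rpow_of_nonneg _ _ (by positivity), ← ENNReal.rpow_mul,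
    mul_one_div_cancel hs0.ne', ENNReal.rpow_one]

theorem rotNorm_add_le {p : ℝ≥0∞} (hp : 1 ≤ p) {F G : ℝ → ℝ≥0∞} (hF : Measurable F)
    (hG : Measurable G) : rotNorm p (fun η => F η + G η) ≤ rotNorm p F + rotNorm p G := by
  obtain ⟨ν, s, _, hs, -, h⟩ := exists_measure_rotNorm hp (q := 1) (by simpa using hp)
  simpa only [h] using! ENNReal.lintegral_Lp_add_le hF.aemeasurable hG.aemeasurable hs

theorem rotNorm_lintegral_le {p : ℝ≥0∞} (hp : 1 ≤ p) {α : Type*} [MeasurableSpace α]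
    (μ : Measure α) [IsFiniteMeasure μ] {φ : α → ℝ → ℝ≥0∞} (hφ : Measurable (Function.uncurry φ))
    {w : α → ℝ≥0∞} (hw : AEMeasurable w μ) (hw1 : ∀ᵐ t ∂μ, w t ≠ ∞)
    (hφw : ∀ᵐ t ∂μ, rotNorm p (φ t) ≤ w t) :
    rotNorm p (fun η => ∫⁻ t, φ t η ∂μ) ≤ ∫⁻ t, w t ∂μ := by
  obtain ⟨ν, s, _, hs, -, h⟩ := exists_measure_rotNorm hp (q := 1) (by simpa using hp)
  simp only [h] at hφw ⊢
  exact minkowski μ ν hs hφ hw hw1 hφw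

/-! ### The geometry of the disk -/

theorem mem_unitDisk {z : ℂ} : z ∈ unitDisk ↔ ‖z‖ < 1 := by simp [unitDisk]

theorem mem_closedUnitDisk {z : ℂ} : z ∈ closedUnitDisk ↔ ‖z‖ ≤ 1 := by simp [closedUnitDisk]

theorem isOpen_unitDisk : IsOpen unitDisk := isOpen_ball

theorem unitDisk_subset : unitDisk ⊆ closedUnitDisk := ball_subset_closedBall

@[simp] theorem norm_rot (η : ℝ) : ‖rot η‖ = 1 := Complex.norm_exp_ofReal_mul_I η

@[simp] theorem rot_zero : rot 0 = 1 := by simp [rot]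

theorem continuous_rot : Continuous rot := by unfold rot; fun_prop

theorem bdryDist_eq {z : ℂ} (hz : z ∈ unitDisk) : bdryDist z = 1 - ‖z‖ := by
  rw [mem_unitDisk] at hz
  have hfr : frontier unitDisk = sphere (0 : ℂ) 1 := frontier_ball 0 one_ne_zero
  have hne : (sphere (0 : ℂ) 1).Nonempty := ⟨1, by simp⟩
  rw [bdryDist, hfr]
  apply le_antisymm
  · obtain ⟨w, hw, hzw⟩ : ∃ w : ℂ, ‖w‖ = 1 ∧ z = ‖z‖ * w := by
      by_cases h : z = 0
      · exact ⟨1, by simp, by simp [h]⟩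
      · have : ‖z‖ ≠ 0 := norm_ne_zero_iff.2 h
        exact ⟨z / ‖z‖, by simp [this], (mul_div_cancel₀ z (by exact_mod_cast this)).symm⟩
    refine (infDist_le_dist_of_mem (y := w) (by simpa using hw)).trans_eq ?_
    have : w - z = ((1 - ‖z‖ : ℝ) : ℂ) * w := by
      conv_lhs => rw [hzw]
      push_cast; ring
    rw [dist_comm, dist_eq_norm, this, norm_mul, hw, mul_one, Complex.norm_real, Real.norm_eq_abs,
      abs_of_pos (by linarith)]
  · refine (le_infDist hne).2 fun w hw => ?_
    have hw : ‖w‖ = 1 := by simpa using hw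
    have := norm_sub_norm_le w z
    rw [dist_comm, dist_eq_norm]
    linarith

theorem bdryDist_pos {z : ℂ} (hz : z ∈ unitDisk) : 0 < bdryDist z := by
  rw [bdryDist_eq hz]; linarith [mem_unitDisk.1 hz]

theorem mul_rot_mem {z : ℂ} (hz : z ∈ unitDisk) (η : ℝ) : z * rot η ∈ unitDisk := by
  rw [mem_unitDisk] at *; simpa

theorem rot_mul_mem_closed {z : ℂ} (hz : z ∈ closedUnitDisk) (η : ℝ) :
    rot η * z ∈ closedUnitDisk := by
  rw [mem_closedUnitDisk] at *; simpa

theorem closedBall_subset_unitDisk {z : ℂ} (hz : z ∈ unitDisk) {r : ℝ} (hr : r < bdryDist z) :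
    closedBall z r ⊆ unitDisk := by
  intro w hw
  rw [bdryDist_eq hz] at hr
  rw [mem_closedBall, dist_eq_norm] at hw
  rw [mem_unitDisk]
  have := norm_le_norm_add_norm_sub' w z
  linarith

/-! ### Harmonic functions as sums of holomorphic and antiholomorphic ones -/

/-- `f` is continuous on the closed disk and `f = h + conj g` in the open disk, with `h` and `g`
holomorphic. -/
structure HarmonicRep (f h g : ℂ → ℂ) : Prop where
  continuousOn : ContinuousOn f closedUnitDisk
  left : DifferentiableOn ℂ h unitDisk
  right : DifferentiableOn ℂ g unitDisk
  eq : ∀ z ∈ unitDisk, f z = h z + conj (g z)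

namespace HarmonicRep

variable {f h g : ℂ → ℂ}

theorem hasFDerivAt (H : HarmonicRep f h g) {z : ℂ} (hz : z ∈ unitDisk) :
    HasFDerivAt f ((ContinuousLinearMap.toSpanSingleton ℂ (deriv h z)).restrictScalars ℝ +
      Complex.conjCLE.toContinuousLinearMap ∘L
        (ContinuousLinearMap.toSpanSingleton ℂ (deriv g z)).restrictScalars ℝ) z := by
  have hU := isOpen_unitDisk.mem_nhds hz
  have h1 := ((H.left.differentiableAt hU).hasDerivAt.hasFDerivAt).restrictScalars ℝ
  have h2 := ((H.right.differentiableAt hU).hasDerivAt.hasFDerivAt).restrictScalars ℝ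
  have h3 := h1.add (Complex.conjCLE.toContinuousLinearMap.hasFDerivAt.comp z h2)
  refine h3.congr_of_eventuallyEq ?_
  filter_upwards [hU] with w hw
  simp [H.eq w hw]

theorem lineDeriv_eq (H : HarmonicRep f h g) {z : ℂ} (hz : z ∈ unitDisk) (v : ℂ) :
    lineDeriv ℝ f z v = v * deriv h z + conj (v * deriv g z) := by
  rw [((H.hasFDerivAt hz).hasLineDerivAt v).lineDeriv]
  simp

theorem dz_eq (H : HarmonicRep f h g) {z : ℂ} (hz : z ∈ unitDisk) : dz f z = deriv h z := by
  rw [dz, H.lineDeriv_eq hz, H.lineDeriv_eq hz]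
  simp only [map_mul, Complex.conj_I, one_mul]
  linear_combination (-(deriv h z) / 2 + conj (deriv g z) / 2) * Complex.I_sq

theorem dzbar_eq (H : HarmonicRep f h g) {z : ℂ} (hz : z ∈ unitDisk) :
    dzbar f z = conj (deriv g z) := by
  rw [dzbar, H.lineDeriv_eq hz, H.lineDeriv_eq hz]
  simp only [map_mul, Complex.conj_I, one_mul]
  linear_combination (deriv h z / 2 - conj (deriv g z) / 2) * Complex.I_sq

theorem maxDeriv_eq (H : HarmonicRep f h g) {z : ℂ} (hz : z ∈ unitDisk) :
    maxDeriv f z = ‖deriv h z‖ + ‖deriv g z‖ := by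
  rw [maxDeriv, H.dz_eq hz, H.dzbar_eq hz, RCLike.norm_conj]

theorem jacobian_eq (H : HarmonicRep f h g) {z : ℂ} (hz : z ∈ unitDisk) :
    jacobian f z = ‖deriv h z‖ ^ 2 - ‖deriv g z‖ ^ 2 := by
  rw [jacobian, H.dz_eq hz, H.dzbar_eq hz, RCLike.norm_conj]

theorem sub_const (H : HarmonicRep f h g) (a : ℂ) :
    HarmonicRep (fun z => f z - a) (fun z => h z - a) g where
  continuousOn := H.continuousOn.sub continuousOn_const
  left := H.left.sub_const a
  right := H.right
  eq z hz := by rw [H.eq z hz]; ring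

/-- `conj g` and `g` have the same real part, so `u = Re(h + g)`. -/
theorem re (H : HarmonicRep f h g) :
    HarmonicRep (rePart f) (fun z => (h z + g z) / 2) (fun z => (h z + g z) / 2) where
  continuousOn := Complex.continuous_ofReal.comp_continuousOn
    (Complex.continuous_re.comp_continuousOn H.continuousOn)
  left := (H.left.add H.right).div_const 2
  right := (H.left.add H.right).div_const 2
  eq z hz := by
    rw [rePart, H.eq z hz, ← map_ofNat (algebraMap ℝ ℂ) 2, Complex.coe_algebraMap,
      Complex.add_conj, Complex.div_ofReal_re]
    simp
    ring

/-- `conj g` and `-g` have the same imaginary part, so `v = Im(h - g)`. -/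
theorem im (H : HarmonicRep f h g) :
    HarmonicRep (imPart f) (fun z => (h z - g z) / (2 * Complex.I))
      (fun z => (h z - g z) / (2 * Complex.I)) where
  continuousOn := Complex.continuous_ofReal.comp_continuousOn
    (Complex.continuous_im.comp_continuousOn H.continuousOn)
  left := (H.left.sub H.right).div_const _
  right := (H.left.sub H.right).div_const _
  eq z hz := by
    rw [imPart, H.eq z hz]
    have e : ∀ w : ℂ, w / (2 * Complex.I) + conj (w / (2 * Complex.I)) = (w.im : ℂ) := by
      intro w
      rw [map_div₀, map_mul, Complex.conj_I, map_ofNat, mul_neg, div_neg, ← sub_eq_add_neg,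
        ← sub_div, Complex.sub_conj]
      field_simp
      push_cast
      ring
    rw [e]
    simp [sub_eq_add_neg]

theorem deriv_re (H : HarmonicRep f h g) {z : ℂ} (hz : z ∈ unitDisk) :
    deriv (fun z => (h z + g z) / 2) z = (deriv h z + deriv g z) / 2 := by
  have hU := isOpen_unitDisk.mem_nhds hz
  exact (((H.left.differentiableAt hU).hasDerivAt.add
    (H.right.differentiableAt hU).hasDerivAt).div_const 2).deriv

theorem deriv_im (H : HarmonicRep f h g) {z : ℂ} (hz : z ∈ unitDisk) :
    deriv (fun z => (h z - g z) / (2 * Complex.I)) z =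
      (deriv h z - deriv g z) / (2 * Complex.I) := by
  have hU := isOpen_unitDisk.mem_nhds hz
  exact (((H.left.differentiableAt hU).hasDerivAt.sub
    (H.right.differentiableAt hU).hasDerivAt).div_const _).deriv

theorem maxDeriv_re (H : HarmonicRep f h g) {z : ℂ} (hz : z ∈ unitDisk) :
    maxDeriv (rePart f) z = ‖deriv h z + deriv g z‖ := by
  rw [H.re.maxDeriv_eq hz, H.deriv_re hz]
  simp

theorem maxDeriv_im (H : HarmonicRep f h g) {z : ℂ} (hz : z ∈ unitDisk) :
    maxDeriv (imPart f) z = ‖deriv h z - deriv g z‖ := by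
  rw [H.im.maxDeriv_eq hz, H.deriv_im hz]
  simp

end HarmonicRep

theorem HarmonicRep.of_diffContOnCl {h : ℂ → ℂ} (hh : DiffContOnCl ℂ h unitDisk) :
    HarmonicRep h h 0 where
  continuousOn := by
    have := hh.continuousOn
    rwa [unitDisk, closure_ball _ one_ne_zero] at this
  left := hh.differentiableOn
  right := differentiableOn_const 0
  eq z _ := by simp

/-! ### Circle means against a nonnegative trigonometric kernel -/

theorem circleAverage_inv_mul {h : ℂ → ℂ} {z : ℂ} {r : ℝ} (hr : 0 < r)
    (hh : DifferentiableOn ℂ h (closedBall z r)) :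
    circleAverage (fun ζ => (ζ - z)⁻¹ * h ζ) z r = deriv h z := by
  have hc : DiffContOnCl ℂ h (ball z r) := hh.diffContOnCl_ball subset_rfl
  rw [circleAverage_eq_circleIntegral hr.ne']
  have := hc.deriv_eq_smul_circleIntegral hr
  have e : (∮ ζ in C(z, r), (ζ - z)⁻¹ • ((ζ - z)⁻¹ * h ζ)) =
      ∮ ζ in C(z, r), (1 / (ζ - z) ^ 2) • h ζ := by
    congr 1
    ext ζ
    simp only [smul_eq_mul]
    rw [one_div, sq, mul_inv, mul_assoc]
  rw [e, this, smul_smul, inv_mul_cancel₀ Complex.two_pi_I_ne_zero, one_smul]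

/-- The three terms are the mean value property, Cauchy's formula for the derivative, and the mean
value of a function vanishing at `z`. On the circle the kernel is real exactly when its last two
terms have real sum, as for `b = conj a / r ^ 2`. -/
theorem circleAverage_kernel_mul {h : ℂ → ℂ} {z : ℂ} {r : ℝ} (hr : 0 < r)
    (hh : DifferentiableOn ℂ h (closedBall z r)) (a b : ℂ) :
    circleAverage (fun ζ => (2 + a * (ζ - z)⁻¹ + b * (ζ - z)) * h ζ) z r
      = 2 * h z + a * deriv h z := by
  have hc : DiffContOnCl ℂ h (ball z r) := hh.diffContOnCl_ball subset_rfl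
  have hcont : ContinuousOn h (sphere z r) := hh.continuousOn.mono sphere_subset_closedBall
  have hinv : ContinuousOn (fun ζ : ℂ => (ζ - z)⁻¹) (sphere z r) := by
    refine ContinuousOn.inv₀ (by fun_prop) fun ζ hζ => ?_
    rw [sub_ne_zero]
    rintro rfl
    simp at hζ
    exact hr.ne hζ
  have i1 : CircleIntegrable (fun ζ => (2 : ℂ) * h ζ) z r :=
    (continuousOn_const.mul hcont).circleIntegrable hr.le
  have i2 : CircleIntegrable (fun ζ => a * ((ζ - z)⁻¹ * h ζ)) z r :=
    (continuousOn_const.mul (hinv.mul hcont)).circleIntegrable hr.le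
  have hlin : ContinuousOn (fun ζ : ℂ => ζ - z) (sphere z r) := by fun_prop
  have i3 : CircleIntegrable (fun ζ => b * ((ζ - z) * h ζ)) z r :=
    (continuousOn_const.mul (hlin.mul hcont)).circleIntegrable hr.le
  have e : (fun ζ => (2 + a * (ζ - z)⁻¹ + b * (ζ - z)) * h ζ) = fun ζ =>
      ((2 : ℂ) * h ζ + a * ((ζ - z)⁻¹ * h ζ)) + b * ((ζ - z) * h ζ) := by
    ext ζ; ring
  have m1 : circleAverage h z r = h z := by
    have := DiffContOnCl.circleAverage (f := h) (c := z) (R := r) (by rwa [abs_of_pos hr])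
    exact this
  have m3 : circleAverage (fun ζ => (ζ - z) * h ζ) z r = 0 := by
    have hd : DifferentiableOn ℂ (fun ζ => (ζ - z) * h ζ) (closedBall z r) :=
      (by fun_prop : DifferentiableOn ℂ (fun ζ : ℂ => ζ - z) (closedBall z r)).mul hh
    have := DiffContOnCl.circleAverage (f := fun ζ => (ζ - z) * h ζ) (c := z) (R := r)
      (by rw [abs_of_pos hr]; exact hd.diffContOnCl_ball subset_rfl)
    simpa using this
  have s1 := circleAverage_fun_smul (a := (2 : ℂ)) (f := h) (c := z) (R := r)
  have s2 := circleAverage_fun_smul (a := a) (f := fun ζ => (ζ - z)⁻¹ * h ζ) (c := z) (R := r)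
  have s3 := circleAverage_fun_smul (a := b) (f := fun ζ => (ζ - z) * h ζ) (c := z) (R := r)
  simp only [smul_eq_mul] at s1 s2 s3
  rw [e, circleAverage_fun_add (f₁ := fun ζ => 2 * h ζ + a * ((ζ - z)⁻¹ * h ζ)) (i1.add i2) i3, circleAverage_fun_add i1 i2, s1, s2, s3, m1, m3,
    circleAverage_inv_mul hr hh]
  ring

/-- The gradient of a harmonic function at the centre of a circle, in the direction of the value
there, is dominated by the mean oscillation of the modulus. -/
theorem HarmonicRep.mul_norm_le_circleAverage {f h g : ℂ → ℂ} (H : HarmonicRep f h g) {z : ℂ}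
    {r : ℝ} (hr : 0 < r) (hzr : closedBall z r ⊆ unitDisk) {c : ℂ} (hc : ‖c‖ = 1)
    (hfc : f z = ‖f z‖ * c) :
    r * ‖conj c * deriv h z + c * deriv g z‖ ≤
      4 * circleAverage (fun ζ => |‖f ζ‖ - ‖f z‖|) z r := by
  have hz : z ∈ unitDisk := hzr (mem_closedBall_self hr.le)
  have hS : sphere z r ⊆ unitDisk := sphere_subset_closedBall.trans hzr
  set X := conj c * deriv h z + c * deriv g z with hX
  -- The phase `l` aligns the kernel with `X`, so that averaging yields `|X|` rather than a real
  -- part.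
  obtain ⟨l, hl, hlX⟩ : ∃ l : ℂ, ‖l‖ = 1 ∧ l * X = ‖X‖ := by
    by_cases h0 : X = 0
    · exact ⟨1, by simp, by simp [h0]⟩
    · have h0' : (‖X‖ : ℂ) ≠ 0 := by simpa using h0
      refine ⟨conj X / ‖X‖, by simp [h0], ?_⟩
      rw [div_mul_eq_mul_div, mul_comm, Complex.mul_conj, Complex.normSq_eq_norm_sq]
      field_simp
      push_cast
      ring
  set k : ℂ → ℂ := fun ζ => 2 + (l * r) * (ζ - z)⁻¹ + (conj l / r) * (ζ - z) with hk
  have hrC : (r : ℂ) ≠ 0 := by exact_mod_cast hr.ne'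
  have hne : ∀ ζ ∈ sphere z r, ζ - z ≠ 0 := by
    intro ζ hζ h0
    rw [mem_sphere, dist_eq_norm, h0, norm_zero] at hζ
    exact hr.ne hζ
  have hconj : ∀ ζ ∈ sphere z r, (conj l / r) * (ζ - z) = conj ((l * r) * (ζ - z)⁻¹) := by
    intro ζ hζ
    have h1 : (ζ - z) * conj (ζ - z) = (r : ℂ) ^ 2 := by
      rw [mem_sphere, dist_eq_norm] at hζ
      rw [Complex.mul_conj, Complex.normSq_eq_norm_sq, hζ]
      push_cast; rfl
    have h2 : conj (ζ - z) ≠ 0 := (map_ne_zero _).2 (hne ζ hζ)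
    rw [map_mul, map_mul, map_inv₀, Complex.conj_ofReal]
    field_simp
    linear_combination (conj l) * h1
  have hkre : ∀ ζ ∈ sphere z r, k ζ = ((k ζ).re : ℂ) := by
    intro ζ hζ
    rw [eq_comm, ← Complex.conj_eq_iff_re, hk]
    simp only [hconj ζ hζ, map_add, Complex.conj_conj, map_ofNat]
    ring
  have hknorm : ∀ ζ ∈ sphere z r, 0 ≤ (k ζ).re ∧ (k ζ).re ≤ 4 := by
    intro ζ hζ
    have h1 : ‖(l * r) * (ζ - z)⁻¹‖ = 1 := by
      rw [mem_sphere, dist_eq_norm] at hζ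
      rw [norm_mul, norm_mul, norm_inv, hζ, hl, Complex.norm_real, Real.norm_eq_abs, abs_of_pos hr]
      field_simp
    have h2 := Complex.abs_re_le_norm ((l * r) * (ζ - z)⁻¹)
    rw [h1, abs_le] at h2
    have h3 : (k ζ).re = 2 + 2 * ((l * r) * (ζ - z)⁻¹).re := by
      simp only [hk, hconj ζ hζ, Complex.add_re, Complex.conj_re, Complex.re_ofNat]
      ring
    constructor <;> linarith
  have hkc : ContinuousOn k (sphere z r) := by
    have : ContinuousOn (fun ζ : ℂ => (ζ - z)⁻¹) (sphere z r) :=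
      ContinuousOn.inv₀ (by fun_prop) hne
    fun_prop
  have hfS : ContinuousOn f (sphere z r) := H.continuousOn.mono (hS.trans unitDisk_subset)
  have hhS : ContinuousOn h (sphere z r) := H.left.continuousOn.mono hS
  have hgS : ContinuousOn g (sphere z r) := H.right.continuousOn.mono hS
  have m1 : circleAverage (fun ζ => k ζ * h ζ) z r = 2 * h z + l * r * deriv h z :=
    circleAverage_kernel_mul hr (H.left.mono hzr) (l * r) (conj l / r)
  have m2 : circleAverage (fun ζ => k ζ * g ζ) z r = 2 * g z + l * r * deriv g z :=
    circleAverage_kernel_mul hr (H.right.mono hzr) (l * r) (conj l / r)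
  have m0 : circleAverage (fun ζ => k ζ * 1) z r = 2 := by
    refine (circleAverage_kernel_mul (h := fun _ => 1) hr (differentiableOn_const 1)
      (l * r) (conj l / r)).trans ?_
    simp
  have i1 : CircleIntegrable (fun ζ => k ζ * h ζ) z r := (hkc.mul hhS).circleIntegrable hr.le
  have i2 : CircleIntegrable (fun ζ => k ζ * g ζ) z r := (hkc.mul hgS).circleIntegrable hr.le
  have i0 : CircleIntegrable (fun ζ => k ζ * 1) z r :=
    (hkc.mul continuousOn_const).circleIntegrable hr.le
  have i3 : CircleIntegrable (fun ζ => k ζ * f ζ) z r := (hkc.mul hfS).circleIntegrable hr.le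
  have i4 : CircleIntegrable (fun ζ => conj (k ζ * g ζ)) z r :=
    (Complex.continuous_conj.comp_continuousOn (hkc.mul hgS)).circleIntegrable hr.le
  have m4 : circleAverage (fun ζ => conj (k ζ * g ζ)) z r =
      conj (circleAverage (fun ζ => k ζ * g ζ) z r) :=
    Complex.conjCLE.toContinuousLinearMap.circleAverage_comp_comm i2
  -- The kernel is real on the circle, so it passes through the conjugation and acts on `g` as it
  -- does on `h`.
  have m3 : circleAverage (fun ζ => k ζ * f ζ) z r =
      2 * f z + r * (l * deriv h z + conj (l * deriv g z)) := by
    have e : circleAverage (fun ζ => k ζ * f ζ) z r =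
        circleAverage (fun ζ => k ζ * h ζ + conj (k ζ * g ζ)) z r := by
      refine circleAverage_congr_sphere fun ζ hζ => ?_
      rw [abs_of_pos hr] at hζ
      rw [H.eq ζ (hS hζ), map_mul, hkre ζ hζ, Complex.conj_ofReal]
      ring
    rw [e, circleAverage_fun_add i1 i4, m4]
    rw [m1, m2, H.eq z hz]
    simp only [map_add, map_mul, map_ofNat, Complex.conj_ofReal]
    ring
  have cc : conj c * c = 1 := by
    rw [mul_comm, Complex.mul_conj, Complex.normSq_eq_norm_sq, hc]; simp
  let T : ℂ →L[ℝ] ℝ := Complex.reCLM ∘L (ContinuousLinearMap.mul ℝ ℂ (conj c))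
  have hT : ∀ w, T w = (conj c * w).re := fun w => rfl
  have m5 : circleAverage (fun ζ => (conj c * (k ζ * f ζ)).re) z r = 2 * ‖f z‖ + r * ‖X‖ := by
    have e := T.circleAverage_comp_comm i3
    rw [m3, hT] at e
    refine Eq.trans e ?_
    have e1 : conj c * (2 * f z + r * (l * deriv h z + conj (l * deriv g z))) =
        ((2 * ‖f z‖ : ℝ) : ℂ) + r * (conj c * (l * deriv h z) + conj (c * (l * deriv g z))) := by
      conv_lhs => rw [hfc]
      simp only [map_mul]
      push_cast
      linear_combination (2 * (‖f z‖ : ℂ)) * cc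
    have e2 : (conj c * (l * deriv h z) + conj (c * (l * deriv g z))).re = ‖X‖ := by
      rw [Complex.add_re, Complex.conj_re, ← Complex.add_re]
      have : conj c * (l * deriv h z) + c * (l * deriv g z) = (‖X‖ : ℂ) := by
        rw [← hlX, hX]; ring
      rw [this, Complex.ofReal_re]
    rw [e1, Complex.add_re, Complex.ofReal_re, Complex.re_ofReal_mul, e2]
  have m6 : circleAverage (fun ζ => ‖f z‖ * (k ζ * 1).re) z r = ‖f z‖ * 2 := by
    have e := Complex.reCLM.circleAverage_comp_comm i0
    have s := circleAverage_fun_smul (a := ‖f z‖) (f := fun ζ => (k ζ * 1).re) (c := z) (R := r)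
    simp only [smul_eq_mul] at s
    rw [s]
    congr 1
    refine Eq.trans e ?_
    rw [m0]
    simp
  have hreS : ContinuousOn (fun ζ => (k ζ * 1).re) (sphere z r) :=
    Complex.continuous_re.comp_continuousOn (hkc.mul continuousOn_const)
  have i5 : CircleIntegrable (fun ζ => ‖f z‖ * (k ζ * 1).re) z r :=
    (continuousOn_const.mul hreS).circleIntegrable hr.le
  have i6 : CircleIntegrable (fun ζ => 4 * |‖f ζ‖ - ‖f z‖|) z r :=
    (continuousOn_const.mul (hfS.norm.sub continuousOn_const).abs).circleIntegrable hr.le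
  have i7 : CircleIntegrable (fun ζ => (conj c * (k ζ * f ζ)).re) z r :=
    (Complex.continuous_re.comp_continuousOn
      (continuousOn_const.mul (hkc.mul hfS))).circleIntegrable hr.le
  -- Pointwise, `k Re(conj c * f ζ) ≤ k|f ζ| ≤ k|f z| + 4||f ζ| - |f z||`. After averaging, `2|f z|`
  -- cancels on both sides.
  have hle := circleAverage_mono i7 (i5.add i6) fun ζ hζ => by
    rw [abs_of_pos hr] at hζ
    obtain ⟨h0, h4⟩ := hknorm ζ hζ
    have h5 : (conj c * (k ζ * f ζ)).re = (k ζ).re * (conj c * f ζ).re := by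
      rw [hkre ζ hζ, ← Complex.re_ofReal_mul, Complex.ofReal_re]
      congr 1
      ring
    have h6 : (conj c * f ζ).re ≤ ‖f ζ‖ := by
      refine (Complex.re_le_norm _).trans_eq ?_
      rw [norm_mul, RCLike.norm_conj, hc, one_mul]
    simp only [Pi.add_apply, mul_one]
    rw [h5]
    have h7 := abs_nonneg (‖f ζ‖ - ‖f z‖)
    have h8 := le_abs_self (‖f ζ‖ - ‖f z‖)
    nlinarith [mul_le_mul_of_nonneg_left h6 h0, mul_le_mul_of_nonneg_left h8 h0,
      mul_le_mul_of_nonneg_right h4 h7]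
  rw [circleAverage_add i5 i6, m5, m6] at hle
  have s := circleAverage_fun_smul (a := (4 : ℝ)) (f := fun ζ => |‖f ζ‖ - ‖f z‖|) (c := z) (R := r)
  simp only [smul_eq_mul] at s
  rw [s] at hle
  linarith

/-- The free shift `η` of the parametrisation lets a circle about `z * rot η` be written as the
rotated circle about `z`. -/
theorem ofReal_circleAverage_le (F : ℂ → ℝ) (z : ℂ) (r η : ℝ) :
    ENNReal.ofReal (circleAverage F z r) ≤
      ENNReal.ofReal (2 * π)⁻¹ * ∫⁻ θ in Ioc 0 (2 * π), ‖F (circleMap z r (θ + η))‖ₑ := by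
  rw [circleAverage_eq_integral_add η, smul_eq_mul, ENNReal.ofReal_mul (by positivity),
    intervalIntegral.integral_of_le two_pi_pos.le]
  gcongr
  exact (Real.ofReal_le_enorm _).trans (enorm_integral_le_lintegral_enorm _)

theorem IsMajorant.nonneg {ω : ℝ → ℝ} (hω : IsMajorant ω) {t : ℝ} (ht : 0 ≤ t) : 0 ≤ ω t :=
  hω.map_zero ▸ hω.monotoneOn (mem_Ici.2 le_rfl) (mem_Ici.2 ht) ht

theorem lipMean_eq_rotNorm (p : ℝ≥0∞) (f : ℂ → ℂ) (z₁ z₂ : ℂ) :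
    lipMean p f z₁ z₂ = rotNorm p fun η => ‖f (rot η * z₁) - f (rot η * z₂)‖ₑ := by
  simp [lipMean, rotNorm]

theorem derivMean_eq_rotNorm (p : ℝ≥0∞) (f : ℂ → ℂ) (z : ℂ) :
    derivMean p f z = rotNorm p fun η => ENNReal.ofReal (maxDeriv f (z * rot η)) := by
  simp [derivMean, rotNorm]

theorem rot_mul_circleMap (η θ r : ℝ) (z : ℂ) :
    circleMap (z * rot η) r (θ + η) = rot η * circleMap z r θ := by
  simp only [circleMap, rot]
  push_cast
  rw [add_mul, Complex.exp_add]
  ring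

theorem bdryDist_mul_rot {z : ℂ} (hz : z ∈ unitDisk) (η : ℝ) :
    bdryDist (z * rot η) = bdryDist z := by
  rw [bdryDist_eq hz, bdryDist_eq (mul_rot_mem hz η)]
  simp

/-! ### From Lipschitz conditions to growth of the derivative -/

/-- The circle bound is used at radius `d(z)/2`. Minkowski moves the mean over rotations inside the
circle integral, where it becomes `lipMean` of two points at distance `d(z)/2`. -/
theorem growthBound_of_circle_bound {p : ℝ≥0∞} (hp : 1 ≤ p) {ω : ℝ → ℝ} (hω : IsMajorant ω)
    {f F : ℂ → ℂ} {C : ℝ} (hC : 0 < C) (hFc : ContinuousOn F closedUnitDisk)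
    (hF : MemLipschitz ω p F)
    (hb : ∀ z ∈ unitDisk, ∀ r, 0 < r → r < bdryDist z →
      r * maxDeriv f z ≤ C * circleAverage (fun ζ => ‖F ζ - F z‖) z r) :
    GrowthBound ω (derivMean p f) := by
  obtain ⟨-, M, hM, hMF⟩ := hF
  refine ⟨2 * C * M, by positivity, fun z hz => ?_⟩
  have hd := bdryDist_pos hz
  set r := bdryDist z / 2 with hr
  have hr0 : 0 < r := by positivity
  have hrd : r < bdryDist z := by linarith
  have hmem : ∀ θ, circleMap z r θ ∈ closedUnitDisk := fun θ =>
    unitDisk_subset (closedBall_subset_unitDisk hz hrd (circleMap_mem_closedBall z hr0.le θ))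
  have hcont : Continuous fun x : ℝ × ℝ =>
      F (rot x.2 * circleMap z r x.1) - F (rot x.2 * z) := by
    have c1 : Continuous fun x : ℝ × ℝ => rot x.2 * circleMap z r x.1 :=
      (continuous_rot.comp continuous_snd).mul ((continuous_circleMap z r).comp continuous_fst)
    have c2 : Continuous fun x : ℝ × ℝ => rot x.2 * z :=
      (continuous_rot.comp continuous_snd).mul continuous_const
    exact (hFc.comp_continuous c1 fun x => rot_mul_mem_closed (hmem _) _).sub
      (hFc.comp_continuous c2 fun x => rot_mul_mem_closed (unitDisk_subset hz) _)
  set c : ℝ≥0∞ := ENNReal.ofReal (C / r) * ENNReal.ofReal (2 * π)⁻¹ with hc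
  have hpt : ∀ η, ENNReal.ofReal (maxDeriv f (z * rot η)) ≤
      c * ∫⁻ θ in Ioc 0 (2 * π), ‖F (rot η * circleMap z r θ) - F (rot η * z)‖ₑ := by
    intro η
    have h1 := hb (z * rot η) (mul_rot_mem hz η) r hr0 (by rwa [bdryDist_mul_rot hz])
    have h2 : maxDeriv f (z * rot η) ≤
        (C / r) * circleAverage (fun ζ => ‖F ζ - F (z * rot η)‖) (z * rot η) r := by
      rw [div_mul_eq_mul_div, le_div_iff₀ hr0]
      linarith
    refine (ENNReal.ofReal_le_ofReal h2).trans ?_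
    rw [ENNReal.ofReal_mul (by positivity), hc, mul_assoc]
    gcongr
    refine (ofReal_circleAverage_le _ _ _ η).trans_eq ?_
    simp only [rot_mul_circleMap, enorm_norm]
    simp only [mul_comm z]
  have hc1 : c ≠ ∞ := ENNReal.mul_ne_top ENNReal.ofReal_ne_top ENNReal.ofReal_ne_top
  rw [derivMean_eq_rotNorm]
  refine (rotNorm_mono hpt).trans ?_
  rw [rotNorm_const_mul hp hc1]
  have key := rotNorm_lintegral_le hp (volume.restrict (Ioc 0 (2 * π)))
    (φ := fun θ η => ‖F (rot η * circleMap z r θ) - F (rot η * z)‖ₑ)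
    hcont.enorm.measurable (w := fun _ => ENNReal.ofReal (M * ω r)) aemeasurable_const
    (.of_forall fun _ => ENNReal.ofReal_ne_top) (.of_forall fun θ => by
      have := hMF _ (hmem θ) _ (unitDisk_subset hz)
      rw [lipMean_eq_rotNorm] at this
      simpa [circleMap_sub_center, abs_of_pos hr0] using this)
  refine (mul_le_mul' le_rfl key).trans ?_
  have hωr := hω.nonneg hr0.le
  rw [lintegral_const, Measure.restrict_apply_univ, Real.volume_Ioc, hc,
    ← ENNReal.ofReal_mul (by positivity), ← ENNReal.ofReal_mul (by positivity),
    ← ENNReal.ofReal_mul (by positivity)]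
  apply ENNReal.ofReal_le_ofReal
  -- The factor 2 comes from `1/r = 2/d(z)`; it remains to use `ω r ≤ ω (d(z))`.
  have e : C / r * (2 * π)⁻¹ * (M * ω r * (2 * π - 0)) = 2 * C * M * (ω r / bdryDist z) := by
    rw [hr]
    field_simp
    ring
  rw [e]
  gcongr
  exact hω.monotoneOn (mem_Ici.2 hr0.le) (mem_Ici.2 hd.le) hrd.le

theorem HarmonicRep.growthBound_of_modulus {p : ℝ≥0∞} (hp : 1 ≤ p) {ω : ℝ → ℝ}
    (hω : IsMajorant ω) {f h g : ℂ → ℂ} (H : HarmonicRep f h g) {κ : ℝ} (hκ : 0 < κ)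
    (hb : ∀ z ∈ unitDisk, ∃ c : ℂ, ‖c‖ = 1 ∧ f z = ‖f z‖ * c ∧
      maxDeriv f z ≤ κ * ‖conj c * deriv h z + c * deriv g z‖)
    (hL : MemLipschitz ω p (modulus f)) : GrowthBound ω (derivMean p f) := by
  refine growthBound_of_circle_bound (F := modulus f) hp hω (C := κ * 4) (by positivity)
    (Complex.continuous_ofReal.comp_continuousOn H.continuousOn.norm) hL fun z hz r hr hrd => ?_
  obtain ⟨c, hc, hfc, hle⟩ := hb z hz
  have h1 := H.mul_norm_le_circleAverage hr (closedBall_subset_unitDisk hz hrd) hc hfc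
  have e : ∀ ζ, ‖modulus f ζ - modulus f z‖ = |‖f ζ‖ - ‖f z‖| := fun ζ => by
    rw [modulus, modulus, ← Complex.ofReal_sub, Complex.norm_real, Real.norm_eq_abs]
  simp only [e]
  calc r * maxDeriv f z ≤ r * (κ * ‖conj c * deriv h z + c * deriv g z‖) := by gcongr
    _ = κ * (r * ‖conj c * deriv h z + c * deriv g z‖) := by ring
    _ ≤ κ * (4 * circleAverage (fun ζ => |‖f ζ‖ - ‖f z‖|) z r) := by gcongr
    _ = _ := by ring

/-- The function `f - f z` vanishes at `z`, so the direction `c` is arbitrary there. The choices `1`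
and `I` bound `|h' + g'|` and `|h' - g'|`, whose sum dominates `|h'| + |g'|`; hence `8 = 4 + 4`. -/
theorem HarmonicRep.growthBound_of_memLipschitz {p : ℝ≥0∞} (hp : 1 ≤ p) {ω : ℝ → ℝ}
    (hω : IsMajorant ω) {f h g : ℂ → ℂ} (H : HarmonicRep f h g) (hL : MemLipschitz ω p f) :
    GrowthBound ω (derivMean p f) := by
  refine growthBound_of_circle_bound (F := f) hp hω (C := 8) (by positivity)
    H.continuousOn hL fun z hz r hr hrd => ?_
  have h1 := (H.sub_const (f z)).mul_norm_le_circleAverage hr (closedBall_subset_unitDisk hz hrd)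
    (c := 1) (by simp) (by simp)
  have h2 := (H.sub_const (f z)).mul_norm_le_circleAverage hr (closedBall_subset_unitDisk hz hrd)
    (c := Complex.I) (by simp) (by simp)
  simp only [deriv_sub_const_fun, sub_self, norm_zero, sub_zero, abs_norm, map_one, one_mul,
    Complex.conj_I] at h1 h2
  have e : -Complex.I * deriv h z + Complex.I * deriv g z =
      -Complex.I * (deriv h z - deriv g z) := by ring
  rw [e, norm_mul, norm_neg, Complex.norm_I, one_mul] at h2
  have h3 : maxDeriv f z ≤ ‖deriv h z + deriv g z‖ + ‖deriv h z - deriv g z‖ := by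
    rw [H.maxDeriv_eq hz]
    have a1 := norm_add_le (deriv h z + deriv g z) (deriv h z - deriv g z)
    have a2 := norm_sub_le (deriv h z + deriv g z) (deriv h z - deriv g z)
    rw [show deriv h z + deriv g z + (deriv h z - deriv g z) = 2 * deriv h z by ring, norm_mul] at a1
    rw [show deriv h z + deriv g z - (deriv h z - deriv g z) = 2 * deriv g z by ring, norm_mul] at a2
    simp only [Complex.norm_ofNat] at a1 a2
    linarith
  nlinarith [mul_le_mul_of_nonneg_left h3 hr.le]

/-! ### From growth of the derivative to Lipschitz conditions -/

theorem HarmonicRep.enorm_sub_le_of_mem {f h g : ℂ → ℂ} (H : HarmonicRep f h g) {a v : ℂ}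
    {s t : ℝ} (hst : s ≤ t) (hmem : ∀ x ∈ Icc s t, a + x * v ∈ unitDisk) :
    ‖f (a + t * v) - f (a + s * v)‖ₑ ≤ ∫⁻ x in Icc s t, ‖v‖ₑ *
      ENNReal.ofReal (‖deriv h (a + x * v)‖ + ‖deriv g (a + x * v)‖) := by
  have hγ : ContDiff ℝ 1 fun x : ℝ => a + x * v :=
    contDiff_const.add (Complex.ofRealCLM.contDiff.mul contDiff_const)
  have hcd : ContDiffOn ℝ 1 (fun x : ℝ => f (a + x * v)) (Icc s t) := by
    have h1 : ContDiffOn ℝ 1 (fun z => h z + conj (g z)) unitDisk :=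
      ((H.left.contDiffOn isOpen_unitDisk).restrict_scalars ℝ).add
        (Complex.conjCLE.contDiff.comp_contDiffOn
          ((H.right.contDiffOn isOpen_unitDisk).restrict_scalars ℝ))
    exact (h1.congr H.eq).comp hγ.contDiffOn hmem
  refine (enorm_sub_le_lintegral_deriv_of_contDiffOn_Icc hcd hst).trans ?_
  refine setLIntegral_mono' measurableSet_Icc fun x hx => ?_
  have hv : HasDerivAt (fun x : ℝ => a + x * v) v x := by
    simpa using ((hasDerivAt_id x).ofReal_comp.mul_const v).const_add a
  have hd := (H.hasFDerivAt (hmem x hx)).comp_hasDerivAt x hv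
  have e := hd.deriv
  simp only [Function.comp_def] at e
  rw [e, ← ofReal_norm, ← ofReal_norm, ← ENNReal.ofReal_mul (norm_nonneg _)]
  apply ENNReal.ofReal_le_ofReal
  simp only [_root_.add_apply, ContinuousLinearMap.comp_apply,
    ContinuousLinearMap.coe_restrictScalars', ContinuousLinearMap.toSpanSingleton_apply]
  refine (norm_add_le _ _).trans_eq ?_
  simp [mul_add]

/-- The endpoint may lie on the unit circle, where `f` is only continuous, so the estimate on `[s,
x]` is passed to the limit `x → t`. -/
theorem HarmonicRep.enorm_sub_le {f h g : ℂ → ℂ} (H : HarmonicRep f h g) {a v : ℂ}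
    {s t : ℝ} (hst : s < t) (hmem : ∀ x ∈ Ico s t, a + x * v ∈ unitDisk)
    (ht : a + t * v ∈ closedUnitDisk) :
    ‖f (a + t * v) - f (a + s * v)‖ₑ ≤ ∫⁻ x in Ioo s t, ‖v‖ₑ *
      ENNReal.ofReal (‖deriv h (a + x * v)‖ + ‖deriv g (a + x * v)‖) := by
  have hγ : Continuous fun x : ℝ => a + x * v := by fun_prop
  have hlim : Tendsto (fun x : ℝ => ‖f (a + x * v) - f (a + s * v)‖ₑ) (𝓝[<] t)
      (𝓝 ‖f (a + t * v) - f (a + s * v)‖ₑ) := by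
    have h1 : Tendsto (fun x : ℝ => a + x * v) (𝓝[<] t) (𝓝[closedUnitDisk] (a + t * v)) := by
      refine tendsto_nhdsWithin_iff.2 ⟨(hγ.tendsto t).mono_left nhdsWithin_le_nhds, ?_⟩
      filter_upwards [Ico_mem_nhdsLT hst] with x hx using unitDisk_subset (hmem x hx)
    exact (((H.continuousOn _ ht).tendsto.comp h1).sub_const _).enorm
  have : (𝓝[<] t).NeBot := inferInstance
  refine le_of_tendsto hlim ?_
  filter_upwards [Ico_mem_nhdsLT hst] with x hx
  refine (H.enorm_sub_le_of_mem hx.1 fun y hy => hmem y ⟨hy.1, hy.2.trans_lt hx.2⟩).trans ?_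
  rw [← restrict_Ioo_eq_restrict_Icc]
  exact lintegral_mono_set (Ioo_subset_Ioo_right hx.2.le)

theorem HarmonicRep.lipMean_le {p : ℝ≥0∞} (hp : 1 ≤ p) {f h g : ℂ → ℂ} (H : HarmonicRep f h g)
    {a v : ℂ} {s t : ℝ} (hst : s < t) (hmem : ∀ x ∈ Ico s t, a + x * v ∈ unitDisk)
    (ht : a + t * v ∈ closedUnitDisk) {w : ℝ → ℝ} (hw : ContinuousOn w (Ioo s t))
    (hle : ∀ x ∈ Ioo s t, derivMean p f (a + x * v) ≤ ENNReal.ofReal (w x)) :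
    lipMean p f (a + t * v) (a + s * v) ≤ ‖v‖ₑ * ∫⁻ x in Ioo s t, ENNReal.ofReal (w x) := by
  set D : ℂ → ℝ≥0∞ := fun z => ENNReal.ofReal (‖deriv h z‖ + ‖deriv g z‖) with hD
  have hDm : Measurable D :=
    ((measurable_deriv h).norm.add (measurable_deriv g).norm).ennreal_ofReal
  have hγm : Measurable fun x : ℝ × ℝ => (a + x.1 * v) * rot x.2 :=
    ((by fun_prop : Continuous fun x : ℝ × ℝ => a + x.1 * v).mul
      (continuous_rot.comp continuous_snd)).measurable
  rw [lipMean_eq_rotNorm]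
  have hpt : ∀ η, ‖f (rot η * (a + t * v)) - f (rot η * (a + s * v))‖ₑ ≤
      ‖v‖ₑ * ∫⁻ x in Ioo s t, D ((a + x * v) * rot η) := by
    intro η
    have e : ∀ x : ℝ, rot η * (a + x * v) = rot η * a + x * (rot η * v) := fun x => by ring
    have := H.enorm_sub_le (a := rot η * a) (v := rot η * v) hst
      (fun x hx => by rw [← e, mul_comm]; exact mul_rot_mem (hmem x hx) η)
      (by rw [← e]; exact rot_mul_mem_closed ht η)
    rw [e, e]
    refine this.trans_eq ?_
    rw [enorm_mul, ← ofReal_norm (rot η), norm_rot, ENNReal.ofReal_one, one_mul,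
      lintegral_const_mul' _ _ enorm_ne_top]
    simp only [← e, hD]
    simp only [mul_comm (rot η)]
  refine (rotNorm_mono hpt).trans ?_
  rw [rotNorm_const_mul hp enorm_ne_top]
  gcongr
  refine rotNorm_lintegral_le hp (volume.restrict (Ioo s t))
    (φ := fun x η => D ((a + x * v) * rot η)) (hDm.comp hγm)
    (hw.aemeasurable measurableSet_Ioo).ennreal_ofReal
    (.of_forall fun _ => ENNReal.ofReal_ne_top) ?_
  filter_upwards [ae_restrict_mem measurableSet_Ioo] with x hx
  refine le_trans (le_of_eq ?_) (hle x hx)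
  rw [derivMean_eq_rotNorm]
  congr 1
  ext η
  rw [hD, H.maxDeriv_eq (mul_rot_mem (hmem x (Ioo_subset_Ico_self hx)) η)]

theorem lipMean_comm (p : ℝ≥0∞) (f : ℂ → ℂ) (z₁ z₂ : ℂ) :
    lipMean p f z₁ z₂ = lipMean p f z₂ z₁ := by
  simp only [lipMean_eq_rotNorm]
  congr 1
  ext η
  rw [← edist_eq_enorm_sub, edist_comm, edist_eq_enorm_sub]

theorem lipMean_self {p : ℝ≥0∞} (hp : 1 ≤ p) (f : ℂ → ℂ) (z : ℂ) : lipMean p f z z = 0 := by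
  simpa [lipMean_eq_rotNorm] using rotNorm_const_mul hp ENNReal.zero_ne_top 0

theorem lipMean_triangle {p : ℝ≥0∞} (hp : 1 ≤ p) {f : ℂ → ℂ} (hf : ContinuousOn f closedUnitDisk)
    {z₁ z₂ z₃ : ℂ} (h₁ : z₁ ∈ closedUnitDisk) (h₂ : z₂ ∈ closedUnitDisk)
    (h₃ : z₃ ∈ closedUnitDisk) :
    lipMean p f z₁ z₃ ≤ lipMean p f z₁ z₂ + lipMean p f z₂ z₃ := by
  simp only [lipMean_eq_rotNorm]
  have hc : ∀ z ∈ closedUnitDisk, Continuous fun η => f (rot η * z) := fun z hz =>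
    hf.comp_continuous (continuous_rot.mul continuous_const) fun η => rot_mul_mem_closed hz η
  refine le_trans (rotNorm_mono fun η => ?_) (rotNorm_add_le hp
    ((hc _ h₁).sub (hc _ h₂)).enorm.measurable ((hc _ h₂).sub (hc _ h₃)).enorm.measurable)
  simp only [← edist_eq_enorm_sub]
  exact edist_triangle _ _ _

theorem measurable_of_continuousOn {f : ℂ → ℂ} (hf : ContinuousOn f closedUnitDisk) :
    Measurable fun z : closedUnitDisk => f z :=
  (continuousOn_iff_continuous_domRestrict.1 hf).measurable

theorem HarmonicRep.memLipschitz_of_growthBound {p : ℝ≥0∞} (hp : 1 ≤ p) {ω : ℝ → ℝ}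
    (hω : IsFastMajorant ω) {f h g : ℂ → ℂ} (H : HarmonicRep f h g)
    (hG : GrowthBound ω (derivMean p f)) : MemLipschitz ω p f := by
  obtain ⟨δ₀, hδ₀, M₀, hM₀, hint⟩ := hω.exists_integral_le
  obtain ⟨M, hM, hMG⟩ := hG
  -- Any step `d ≤ δ₁` satisfies `d < δ₀`, so fastness applies, and `d ≤ 1/2`, so `1 - d` stays
  -- positive.
  set δ₁ := min δ₀ 1 / 2 with hδ₁
  have hδ₁0 : 0 < δ₁ := by positivity
  have hδ₁1 : δ₁ ≤ 1 / 2 := by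
    have := min_le_right δ₀ 1
    linarith
  have hδ₁δ₀ : δ₁ < δ₀ := by
    have := min_le_left δ₀ 1
    linarith
  refine ⟨measurable_of_continuousOn H.continuousOn, 2 * (M * M₀) + M * (2 / δ₁), by positivity,
    fun z₁ hz₁ z₂ hz₂ => ?_⟩
  by_cases hne : z₁ = z₂
  · subst hne
    simp [lipMean_self hp]
  have hδ : 0 < ‖z₁ - z₂‖ := norm_pos_iff.2 (sub_ne_zero.2 hne)
  set δ := ‖z₁ - z₂‖ with hδdef
  set d := min δ δ₁ with hd
  have hd0 : 0 < d := lt_min hδ hδ₁0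
  have hdδ : d ≤ δ := min_le_left _ _
  have hd1 : d ≤ δ₁ := min_le_right _ _
  have hωd : ω d ≤ ω δ := hω.monotoneOn (mem_Ici.2 hd0.le) (mem_Ici.2 hδ.le) hdδ
  have hω0 : 0 ≤ ω d := hω.toIsMajorant.nonneg hd0.le
  have hωδ0 : 0 ≤ ω δ := hω0.trans hωd
  have hdiv : ∀ z ∈ unitDisk, ∀ t : ℝ, 0 < t → t ≤ 1 - ‖z‖ →
      derivMean p f z ≤ ENNReal.ofReal (M * (ω t / t)) := by
    intro z hz t ht htz
    refine (hMG z hz).trans (ENNReal.ofReal_le_ofReal ?_)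
    rw [bdryDist_eq hz]
    exact mul_le_mul_of_nonneg_left
      (hω.antitoneOn_div (mem_Ioi.2 ht) (mem_Ioi.2 (ht.trans_le htz)) htz) hM.le
  -- Along the radius, `x * z` is at distance at least `1 - x` from the circle, so the derivative
  -- integral is at most `M ∫₀^d ω(t)/t dt`.
  have hrad : ∀ z ∈ closedUnitDisk, lipMean p f z ((1 - d : ℝ) * z) ≤
      ENNReal.ofReal (M * M₀ * ω δ) := by
    intro z hz
    have hz' := mem_closedUnitDisk.1 hz
    have hn : ∀ x : ℝ, 0 ≤ x → ‖(0 : ℂ) + x * z‖ ≤ x := fun x hx => by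
      rw [zero_add, norm_mul, Complex.norm_real, Real.norm_eq_abs, abs_of_nonneg hx]
      exact mul_le_of_le_one_right hx hz'
    have hx0 : ∀ x ∈ Ico (1 - d) 1, 0 ≤ x := fun x hx => by linarith [hx.1]
    have h1 := H.lipMean_le hp (a := 0) (v := z) (s := 1 - d) (t := 1) (by linarith)
      (fun x hx => mem_unitDisk.2 ((hn x (hx0 x hx)).trans_lt hx.2))
      (by simpa using hz) (w := fun x => M * (ω (1 - x) / (1 - x)))
      (by
        have c1 : ContinuousOn (fun x : ℝ => 1 - x) (Ioo (1 - d) 1) := by fun_prop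
        exact continuousOn_const.mul ((hω.continuousOn.comp c1 fun x hx =>
          mem_Ici.2 (by linarith [hx.2])).div c1 fun x hx => by linarith [hx.2]))
      (fun x hx => by
        have hx' := hx0 x (Ioo_subset_Ico_self hx)
        exact hdiv _ (mem_unitDisk.2 ((hn x hx').trans_lt hx.2)) _ (by linarith [hx.2])
          (by linarith [hn x hx']))
    simp only [zero_add, Complex.ofReal_one, one_mul] at h1
    refine h1.trans ?_
    have hz1 : ‖z‖ₑ ≤ 1 := by
      rw [← ofReal_norm]
      exact ENNReal.ofReal_le_one.2 hz'
    refine (mul_le_of_le_one_left' hz1).trans ?_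
    have hsub : ∫⁻ x in Ioo (1 - d) 1, ENNReal.ofReal (M * (ω (1 - x) / (1 - x))) =
        ∫⁻ t in Ioo 0 d, ENNReal.ofReal (M * (ω t / t)) := by
      have hmp := Measure.measurePreserving_sub_left (volume : Measure ℝ) 1
      have hpre : (fun x : ℝ => 1 - x) ⁻¹' (Ioo 0 d) = Ioo (1 - d) 1 := by
        ext x; simp only [mem_preimage, mem_Ioo]; constructor <;> rintro ⟨_, _⟩ <;>
          constructor <;> linarith
      rw [← hpre]
      exact hmp.setLIntegral_comp_preimage_emb
        (MeasurableEquiv.subLeft (1 : ℝ)).measurableEmbedding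
        (fun t => ENNReal.ofReal (M * (ω t / t))) (Ioo 0 d)
    rw [hsub]
    simp only [ENNReal.ofReal_mul hM.le]
    rw [lintegral_const_mul' _ _ ENNReal.ofReal_ne_top]
    refine (mul_le_mul' le_rfl (hint d ⟨hd0, hd1.trans_lt hδ₁δ₀⟩)).trans ?_
    rw [← ENNReal.ofReal_mul hM.le, mul_assoc]
    apply ENNReal.ofReal_le_ofReal
    gcongr
  have hρ : ∀ z ∈ closedUnitDisk, ((1 - d : ℝ) : ℂ) * z ∈ closedBall (0 : ℂ) (1 - d) := by
    intro z hz
    have h0 : 0 ≤ 1 - d := by linarith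
    rw [mem_closedBall_zero_iff, norm_mul, Complex.norm_real, Real.norm_eq_abs, abs_of_nonneg h0]
    exact mul_le_of_le_one_right h0 (mem_closedUnitDisk.1 hz)
  have hsub : closedBall (0 : ℂ) (1 - d) ⊆ unitDisk := closedBall_subset_ball (by linarith)
  have hseg : lipMean p f ((1 - d : ℝ) * z₁) ((1 - d : ℝ) * z₂) ≤
      ENNReal.ofReal (M * (2 / δ₁) * ω δ) := by
    set a : ℂ := ((1 - d : ℝ) : ℂ) * z₂ with ha
    set b : ℂ := ((1 - d : ℝ) : ℂ) * z₁ with hb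
    have hmem : ∀ x ∈ Icc (0 : ℝ) 1, a + x * (b - a) ∈ closedBall (0 : ℂ) (1 - d) := by
      intro x hx
      have := (convex_closedBall (0 : ℂ) (1 - d)).add_smul_sub_mem (hρ z₂ hz₂) (hρ z₁ hz₁) hx
      rwa [Complex.real_smul] at this
    have h1 := H.lipMean_le hp (a := a) (v := b - a) (s := 0) (t := 1) one_pos
      (fun x hx => hsub (hmem x (Ico_subset_Icc_self hx)))
      (unitDisk_subset (hsub (hmem 1 (by simp)))) (w := fun _ => M * (ω d / d)) continuousOn_const
      (fun x hx => hdiv _ (hsub (hmem x (Ioo_subset_Icc_self hx))) d hd0 (by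
        have := mem_closedBall_zero_iff.1 (hmem x (Ioo_subset_Icc_self hx))
        linarith))
    simp only [Complex.ofReal_one, one_mul, Complex.ofReal_zero, zero_mul, add_zero,
      add_sub_cancel, lintegral_const, Measure.restrict_apply_univ, Real.volume_Ioo, sub_zero,
      ENNReal.ofReal_one, mul_one] at h1
    refine h1.trans ?_
    rw [← ofReal_norm, ← ENNReal.ofReal_mul (norm_nonneg _)]
    apply ENNReal.ofReal_le_ofReal
    have hba : ‖b - a‖ ≤ δ := by
      rw [ha, hb, ← mul_sub, norm_mul, Complex.norm_real, Real.norm_eq_abs,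
        abs_of_nonneg (by linarith)]
      exact mul_le_of_le_one_left hδ.le (by linarith)
    have hδ2 : δ ≤ 2 := by
      have := norm_sub_le z₁ z₂
      linarith [mem_closedUnitDisk.1 hz₁, mem_closedUnitDisk.1 hz₂]
    -- If `d = δ` the ratio is 1; otherwise `d = δ₁` and `δ ≤ 2`.
    have hratio : δ / d ≤ 2 / δ₁ := by
      rw [div_le_div_iff₀ hd0 hδ₁0]
      rcases min_choice δ δ₁ with h | h
      · rw [hd, h]; nlinarith
      · rw [hd, h]; nlinarith
    calc ‖b - a‖ * (M * (ω d / d)) ≤ δ * (M * (ω d / d)) := by gcongr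
      _ = M * (δ / d) * ω d := by ring
      _ ≤ M * (2 / δ₁) * ω δ := by gcongr
  have m₁ := unitDisk_subset (hsub (hρ z₁ hz₁))
  have m₂ := unitDisk_subset (hsub (hρ z₂ hz₂))
  have t1 := lipMean_triangle hp H.continuousOn hz₁ m₁ hz₂
  have t2 := lipMean_triangle hp H.continuousOn m₁ m₂ hz₂
  have r2 := hrad z₂ hz₂
  rw [lipMean_comm] at r2
  calc lipMean p f z₁ z₂ ≤ ENNReal.ofReal (M * M₀ * ω δ) +
        (ENNReal.ofReal (M * (2 / δ₁) * ω δ) + ENNReal.ofReal (M * M₀ * ω δ)) :=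
        t1.trans (add_le_add (hrad z₁ hz₁) (t2.trans (add_le_add hseg r2)))
    _ = _ := by
      rw [← ENNReal.ofReal_add (by positivity) (by positivity),
        ← ENNReal.ofReal_add (by positivity) (by positivity)]
      congr 1
      ring

/-! ### Sub-mean value property of powers of the modulus of a holomorphic function -/

/-- Jensen's formula: each zero in the disk contributes a nonnegative term. -/
theorem log_norm_le_circleAverage {F : ℂ → ℂ} {c : ℂ} {R : ℝ} (hR : 0 < R)
    (hF : AnalyticOnNhd ℂ F (closedBall c R)) (h0 : F c ≠ 0) :
    log ‖F c‖ ≤ circleAverage (fun ζ => log ‖F ζ‖) c R := by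
  have hF' : AnalyticOnNhd ℂ F (closedBall c |R|) := by rwa [abs_of_pos hR]
  rw [hF'.circleAverage_log_norm hR.ne' h0, le_add_iff_nonneg_left]
  refine finsum_nonneg fun u => ?_
  by_cases hu : u ∈ closedBall c |R|
  · refine mul_nonneg (mod_cast MeromorphicOn.AnalyticOnNhd.divisor_nonneg hF' u) ?_
    by_cases huc : c = u
    · simp [huc]
    · apply log_nonneg
      rw [mem_closedBall, dist_eq_norm', abs_of_pos hR] at hu
      have : 0 < ‖c - u‖ := norm_pos_iff.2 (sub_ne_zero.2 huc)
      rw [← div_eq_mul_inv]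
      exact (one_le_div this).2 hu
  · simp [hu]

/-- The tangent line of `exp` at `q log|F c|` gives `|F|^q ≥ T(1 + q log|F| - q log|F c|)` away from
the zeros, with `T = |F c|^q`. Averaging and applying Jensen leaves `T`, for every `q > 0`. -/
theorem norm_rpow_le_circleAverage {F : ℂ → ℂ} {c : ℂ} {R q : ℝ} (hR : 0 ≤ R) (hq : 0 < q)
    (hF : AnalyticOnNhd ℂ F (closedBall c R)) :
    ‖F c‖ ^ q ≤ circleAverage (fun ζ => ‖F ζ‖ ^ q) c R := by
  rcases hR.eq_or_lt with rfl | hR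
  · simp
  by_cases h0 : F c = 0
  · rw [h0, norm_zero, zero_rpow hq.ne']
    exact circleAverage_nonneg_of_nonneg fun ζ _ => by positivity
  have hS : sphere c |R| ⊆ closedBall c R := by
    rw [abs_of_pos hR]; exact sphere_subset_closedBall
  set T := ‖F c‖ ^ q with hT
  have hFc : 0 < ‖F c‖ := norm_pos_iff.2 h0
  have hT0 : 0 < T := rpow_pos_of_pos hFc q
  set a : ℝ := T * (1 - q * log ‖F c‖) with ha
  set l : ℂ → ℝ := fun ζ => a + (T * q) * log ‖F ζ‖ with hl
  -- With the convention `log 0 = 0`, the tangent bound can fail at zeros of `F`. Setting it to 0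
  -- there alters it only on a discrete set and keeps its average.
  set m : ℂ → ℝ := fun ζ => if F ζ = 0 then 0 else l ζ with hm
  have hlog : CircleIntegrable (fun ζ => log ‖F ζ‖) c R :=
    (hF.mono hS).meromorphicOn.circleIntegrable_log_norm
  have hlogc : CircleIntegrable (fun ζ => (T * q) * log ‖F ζ‖) c R := hlog.const_mul _
  have hli : CircleIntegrable l c R := (circleIntegrable_const a c R).add hlogc
  have hlm : l =ᶠ[codiscreteWithin (sphere c |R|)] m := by
    have h1 := hF.preimage_zero_mem_codiscreteWithin h0 (mem_closedBall_self hR.le)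
      (isConnected_closedBall hR.le)
    filter_upwards [codiscreteWithin_mono hS h1] with ζ hζ
    have : F ζ ≠ 0 := hζ
    simp [hm, this]
  have hmi : CircleIntegrable m c R := hli.congr_codiscreteWithin hlm
  have hpi : CircleIntegrable (fun ζ => ‖F ζ‖ ^ q) c R := by
    refine ContinuousOn.circleIntegrable' ?_
    exact (hF.continuousOn.mono hS).norm.rpow_const fun _ _ => .inr hq.le
  have hle : circleAverage m c R ≤ circleAverage (fun ζ => ‖F ζ‖ ^ q) c R := by
    refine circleAverage_mono hmi hpi fun ζ _ => ?_
    by_cases h : F ζ = 0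
    · simp [hm, h, hq.ne']
    · have hp : 0 < ‖F ζ‖ := norm_pos_iff.2 h
      have e1 : ‖F ζ‖ ^ q = T * exp (q * log ‖F ζ‖ - q * log ‖F c‖) := by
        rw [hT, rpow_def_of_pos hp, rpow_def_of_pos hFc, ← exp_add]
        congr 1
        ring
      simp only [hm, h, if_false]
      rw [e1, hl, ha]
      nlinarith [mul_le_mul_of_nonneg_left
        (add_one_le_exp (q * log ‖F ζ‖ - q * log ‖F c‖)) hT0.le]
  rw [← circleAverage_congr_codiscreteWithin hlm hR.ne'] at hle
  refine le_trans ?_ hle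
  have s := circleAverage_fun_smul (a := T * q) (f := fun ζ => log ‖F ζ‖) (c := c) (R := R)
  simp only [smul_eq_mul] at s
  rw [hl, circleAverage_fun_add (circleIntegrable_const a c R) hlogc, circleAverage_const, s]
  have := mul_le_mul_of_nonneg_left (log_norm_le_circleAverage hR hF h0) (mul_pos hT0 hq).le
  rw [ha]
  linarith

theorem measurePreserving_rotate (z : ℂ) (θ : ℝ) :
    MeasurePreserving (fun ξ : ℂ => z + rot θ * (ξ - z)) := by
  have h1 := (rotation (Circle.exp θ)).measurePreserving
  exact (measurePreserving_add_left (volume : Measure ℂ) z).comp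
    (h1.comp (measurePreserving_sub_right (volume : Measure ℂ) z))

/-- Polar coordinates are replaced by rotation invariance: the circle inequality through each `ξ` is
integrated over the disk, and after Tonelli every rotation about `z` gives the same integral. -/
theorem enorm_rpow_mul_volume_le {F : ℂ → ℂ} (hFm : Measurable F) {z : ℂ} {r q : ℝ} (hq : 0 < q)
    (hF : AnalyticOnNhd ℂ F (ball z r)) :
    ‖F z‖ₑ ^ q * volume (ball z r) ≤ ∫⁻ ξ in ball z r, ‖F ξ‖ₑ ^ q := by
  set I := ∫⁻ ξ in ball z r, ‖F ξ‖ₑ ^ q with hI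
  have hGm : Measurable fun x : ℂ × ℝ => ‖F (z + rot x.2 * (x.1 - z))‖ₑ ^ q := by
    have c1 : Continuous fun x : ℂ × ℝ => z + rot x.2 * (x.1 - z) :=
      continuous_const.add ((continuous_rot.comp continuous_snd).mul
        (continuous_fst.sub continuous_const))
    exact (hFm.comp c1.measurable).enorm.pow_const q
  have hrot : ∀ θ : ℝ, ∫⁻ ξ in ball z r, ‖F (z + rot θ * (ξ - z))‖ₑ ^ q = I := by
    intro θ
    have hpre : (fun ξ : ℂ => z + rot θ * (ξ - z)) ⁻¹' ball z r = ball z r := by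
      ext ξ
      simp [dist_eq_norm]
    have := (measurePreserving_rotate z θ).setLIntegral_comp_preimage
      (measurableSet_ball (x := z) (ε := r)) (hFm.enorm.pow_const q)
    rwa [hpre] at this
  have hpt : ∀ ξ ∈ ball z r, ‖F z‖ₑ ^ q ≤ ENNReal.ofReal (2 * π)⁻¹ *
      ∫⁻ θ in Ioc 0 (2 * π), ‖F (z + rot θ * (ξ - z))‖ₑ ^ q := by
    intro ξ hξ
    rw [mem_ball, dist_eq_norm] at hξ
    have h1 := norm_rpow_le_circleAverage (norm_nonneg (ξ - z)) hq
      (hF.mono (closedBall_subset_ball hξ))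
    rw [← ofReal_norm, ENNReal.ofReal_rpow_of_nonneg (norm_nonneg _) hq.le]
    refine (ENNReal.ofReal_le_ofReal h1).trans ((ofReal_circleAverage_le _ _ _
      (Complex.arg (ξ - z))).trans_eq ?_)
    congr 1
    refine lintegral_congr fun θ => ?_
    have e : circleMap z ‖ξ - z‖ (θ + Complex.arg (ξ - z)) = z + rot θ * (ξ - z) := by
      conv_rhs => rw [← Complex.norm_mul_exp_arg_mul_I (ξ - z)]
      simp only [circleMap, rot]
      push_cast
      rw [add_mul, Complex.exp_add]
      ring
    rw [e, ← ofReal_norm, ← ofReal_norm, ENNReal.ofReal_rpow_of_nonneg (norm_nonneg _) hq.le,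
      Real.norm_of_nonneg (by positivity)]
  calc ‖F z‖ₑ ^ q * volume (ball z r) = ∫⁻ ξ in ball z r, ‖F z‖ₑ ^ q := by
        rw [lintegral_const, Measure.restrict_apply_univ]
    _ ≤ ∫⁻ ξ in ball z r, ENNReal.ofReal (2 * π)⁻¹ *
          ∫⁻ θ in Ioc 0 (2 * π), ‖F (z + rot θ * (ξ - z))‖ₑ ^ q :=
        setLIntegral_mono' measurableSet_ball hpt
    _ = ENNReal.ofReal (2 * π)⁻¹ * ∫⁻ θ in Ioc 0 (2 * π),
          ∫⁻ ξ in ball z r, ‖F (z + rot θ * (ξ - z))‖ₑ ^ q := by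
        rw [lintegral_const_mul' _ _ ENNReal.ofReal_ne_top, lintegral_lintegral_swap]
        exact hGm.aemeasurable
    _ = I := by
        simp only [hrot, lintegral_const, Measure.restrict_apply_univ, Real.volume_Ioc, sub_zero]
        rw [mul_comm I, ← mul_assoc, ← ENNReal.ofReal_mul (by positivity),
          inv_mul_cancel₀ two_pi_pos.ne', ENNReal.ofReal_one, one_mul]

/-! ### Local area means -/

theorem areaMean_eq_rotNorm {q : ℝ} (p : ℝ≥0∞) (f : ℂ → ℂ) (z : ℂ) :
    areaMean q p f z = rotNorm p fun η => localAverage q f z η ^ (1 / q) := by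
  unfold areaMean rotNorm angularNorm
  split_ifs
  · rfl
  · simp only [← ENNReal.rpow_mul, one_div_mul_eq_div]

section AreaMean

variable {u F : ℂ → ℂ}

/-- In the applications `F` is `h' + g'` for `u` and `h' - g'` for `v`. -/
theorem localAverage_eq {q : ℝ} (hu : ∀ z ∈ unitDisk, maxDeriv u z = ‖F z‖) {z : ℂ}
    (hz : z ∈ unitDisk) (η : ℝ) :
    localAverage q u z η = (∫⁻ ξ in ball z (bdryDist z / 2), ‖F (ξ * rot η)‖ₑ ^ q) /
      volume (ball z (bdryDist z / 2)) := by
  rw [localAverage]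
  congr 1
  refine setLIntegral_congr_fun measurableSet_ball fun ξ hξ => ?_
  have hξ' : ξ ∈ unitDisk := closedBall_subset_unitDisk hz (half_lt_self (bdryDist_pos hz))
    (ball_subset_closedBall hξ)
  rw [hu _ (mul_rot_mem hξ' η), ofReal_norm]

theorem derivMean_le_areaMean (hFm : Measurable F) (hF : DifferentiableOn ℂ F unitDisk)
    (hu : ∀ z ∈ unitDisk, maxDeriv u z = ‖F z‖) (p : ℝ≥0∞) {q : ℝ} (hq : 0 < q) {z : ℂ}
    (hz : z ∈ unitDisk) : derivMean p u z ≤ areaMean q p u z := by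
  rw [derivMean_eq_rotNorm, areaMean_eq_rotNorm]
  refine rotNorm_mono fun η => ?_
  have hd := half_pos (bdryDist_pos hz)
  have hsub : ball z (bdryDist z / 2) ⊆ unitDisk := ball_subset_closedBall.trans
    (closedBall_subset_unitDisk hz (half_lt_self (bdryDist_pos hz)))
  rw [one_div, ENNReal.le_rpow_inv_iff hq, localAverage_eq hu hz, hu _ (mul_rot_mem hz η),
    ofReal_norm, ENNReal.le_div_iff_mul_le (.inl (measure_ball_pos _ _ hd).ne')
      (.inl measure_ball_lt_top.ne)]
  refine enorm_rpow_mul_volume_le (F := fun ξ => F (ξ * rot η)) (hFm.comp (measurable_mul_const _))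
    hq ?_
  refine DifferentiableOn.analyticOnNhd (hF.comp (by fun_prop) fun ξ hξ => ?_) isOpen_ball
  exact mul_rot_mem (hsub hξ) η

/-- Minkowski with exponent `s / q` exchanges the area average with the mean over rotations; `q ≤ p`
ensures `s / q ≥ 1`. -/
theorem growthBound_areaMean_of_derivMean (hFm : Measurable F)
    (hu : ∀ z ∈ unitDisk, maxDeriv u z = ‖F z‖) {p : ℝ≥0∞} (hp : 1 ≤ p) {q : ℝ} (hq : 0 < q)
    (hqp : ENNReal.ofReal q ≤ p) {ω : ℝ → ℝ} (hω : IsMajorant ω)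
    (hG : GrowthBound ω (derivMean p u)) : GrowthBound ω (areaMean q p u) := by
  obtain ⟨M, hM, hMG⟩ := hG
  refine ⟨M * 2, by positivity, fun z hz => ?_⟩
  obtain ⟨ν, s, _, hs1, hqs, hN⟩ := exists_measure_rotNorm hp hqp
  have hd0 := bdryDist_pos hz
  set r := bdryDist z / 2 with hr
  have hr0 : 0 < r := by positivity
  have hrd : r < bdryDist z := half_lt_self hd0
  set W := ENNReal.ofReal (M * 2 * (ω (bdryDist z) / bdryDist z)) with hW
  -- On this disk `d(ξ) ≥ d(z)/2`, so `ω(t)/t` at `t = d(ξ)` is at most twice its value at `d(z)`.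
  have hbound : ∀ ξ ∈ ball z r, derivMean p u ξ ≤ W := by
    intro ξ hξ
    have hξ' := closedBall_subset_unitDisk hz hrd (ball_subset_closedBall hξ)
    refine (hMG ξ hξ').trans (ENNReal.ofReal_le_ofReal ?_)
    rw [mul_assoc]
    gcongr
    have hb : r ≤ bdryDist ξ := by
      rw [bdryDist_eq hξ']
      rw [bdryDist_eq hz] at hr
      rw [mem_ball, dist_eq_norm] at hξ
      have := norm_le_norm_add_norm_sub' ξ z
      linarith
    refine (hω.antitoneOn_div (mem_Ioi.2 hr0) (mem_Ioi.2 (hr0.trans_le hb)) hb).trans ?_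
    have hmono : ω r ≤ ω (bdryDist z) :=
      hω.monotoneOn (mem_Ici.2 hr0.le) (mem_Ici.2 hd0.le) hrd.le
    calc ω r / r ≤ ω (bdryDist z) / r := by gcongr
      _ = 2 * (ω (bdryDist z) / bdryDist z) := by rw [hr]; field_simp
  set μ := ProbabilityTheory.cond (volume : Measure ℂ) (ball z r) with hμ
  have hvol : volume (ball z r) ≠ 0 := (measure_ball_pos _ _ hr0).ne'
  have : IsProbabilityMeasure μ :=
    ProbabilityTheory.cond_isProbabilityMeasure_of_finite hvol measure_ball_lt_top.ne
  have hloc : ∀ η, localAverage q u z η = ∫⁻ ξ, ‖F (ξ * rot η)‖ₑ ^ q ∂μ := by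
    intro η
    rw [localAverage_eq hu hz, hμ, ProbabilityTheory.cond, lintegral_smul_measure, smul_eq_mul,
      ENNReal.div_eq_inv_mul]
  have hφ : Measurable (Function.uncurry fun (ξ : ℂ) (η : ℝ) => ‖F (ξ * rot η)‖ₑ ^ q) := by
    have c1 : Continuous fun x : ℂ × ℝ => x.1 * rot x.2 :=
      continuous_fst.mul (continuous_rot.comp continuous_snd)
    exact (hFm.comp c1.measurable).enorm.pow_const q
  have hs0 : 0 < s := by linarith
  have key := minkowski μ ν (s := s / q) ((one_le_div hq).2 hqs) hφ (w := fun _ => W ^ q)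
    aemeasurable_const (.of_forall fun _ => ENNReal.rpow_ne_top_of_nonneg hq.le
      ENNReal.ofReal_ne_top) (by
      refine ProbabilityTheory.ae_cond_of_forall_mem measurableSet_ball fun ξ hξ => ?_
      have hξ' := closedBall_subset_unitDisk hz hrd (ball_subset_closedBall hξ)
      have h1 := hbound ξ hξ
      rw [derivMean_eq_rotNorm, hN] at h1
      have e : ∀ x : ℝ≥0∞, (x ^ q) ^ (s / q) = x ^ s := fun x => by
        rw [← ENNReal.rpow_mul, mul_div_cancel₀ _ hq.ne']
      simp only [e]
      rw [show 1 / (s / q) = 1 / s * q by field_simp, ENNReal.rpow_mul]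
      refine ENNReal.rpow_le_rpow (le_trans (le_of_eq ?_) h1) hq.le
      simp only [fun η => hu _ (mul_rot_mem hξ' η), ofReal_norm])
  rw [areaMean_eq_rotNorm, hN]
  simp only [hloc, lintegral_const, measure_univ, mul_one] at key ⊢
  have e1 : ∀ x : ℝ≥0∞, (x ^ (1 / q)) ^ s = x ^ (s / q) := fun x => by
    rw [← ENNReal.rpow_mul, one_div_mul_eq_div]
  simp only [e1]
  have e2 : 1 / s = 1 / (s / q) * (1 / q) := by field_simp
  rw [e2, ENNReal.rpow_mul, one_div q, ENNReal.rpow_inv_le_iff hq]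
  exact key

end AreaMean

/-! ### Comparison of the conditions -/

theorem MemLipschitz.of_norm_sub_le {p : ℝ≥0∞} {ω : ℝ → ℝ} {F G : ℂ → ℂ}
    (hF : MemLipschitz ω p F) (hG : ContinuousOn G closedUnitDisk)
    (hle : ∀ a b, ‖G a - G b‖ ≤ ‖F a - F b‖) : MemLipschitz ω p G := by
  obtain ⟨-, M, hM, hb⟩ := hF
  refine ⟨measurable_of_continuousOn hG, M, hM, fun z₁ h₁ z₂ h₂ => le_trans ?_ (hb z₁ h₁ z₂ h₂)⟩
  rw [lipMean_eq_rotNorm, lipMean_eq_rotNorm]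
  exact rotNorm_mono fun η => enorm_le_iff_norm_le.2 (hle _ _)

theorem norm_modulus_sub_le (f : ℂ → ℂ) (a b : ℂ) :
    ‖modulus f a - modulus f b‖ ≤ ‖f a - f b‖ := by
  rw [modulus, modulus, ← Complex.ofReal_sub, Complex.norm_real]
  exact abs_norm_sub_norm_le _ _

theorem norm_rePart_sub_le (f : ℂ → ℂ) (a b : ℂ) :
    ‖rePart f a - rePart f b‖ ≤ ‖f a - f b‖ := by
  rw [rePart, rePart, ← Complex.ofReal_sub, Complex.norm_real, ← Complex.sub_re]
  exact Complex.abs_re_le_norm _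

theorem norm_imPart_sub_le (f : ℂ → ℂ) (a b : ℂ) :
    ‖imPart f a - imPart f b‖ ≤ ‖f a - f b‖ := by
  rw [imPart, imPart, ← Complex.ofReal_sub, Complex.norm_real, ← Complex.sub_im]
  exact Complex.abs_im_le_norm _

theorem MemLipschitz.modulus {p : ℝ≥0∞} {ω : ℝ → ℝ} {F : ℂ → ℂ} (hF : MemLipschitz ω p F)
    (hFc : ContinuousOn F closedUnitDisk) : MemLipschitz ω p (modulus F) :=
  hF.of_norm_sub_le (Complex.continuous_ofReal.comp_continuousOn hFc.norm) (norm_modulus_sub_le F)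

theorem GrowthBound.mono {ω : ℝ → ℝ} {Q Q' : ℂ → ℝ≥0∞} (hQ : GrowthBound ω Q)
    (hle : ∀ z ∈ unitDisk, Q' z ≤ Q z) : GrowthBound ω Q' := by
  obtain ⟨M, hM, hb⟩ := hQ
  exact ⟨M, hM, fun z hz => (hle z hz).trans (hb z hz)⟩

theorem GrowthBound.of_maxDeriv_le {p : ℝ≥0∞} (hp : 1 ≤ p) {ω : ℝ → ℝ} {f f' : ℂ → ℂ} {κ : ℝ}
    (hκ : 0 < κ) (hle : ∀ z ∈ unitDisk, maxDeriv f z ≤ κ * maxDeriv f' z)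
    (hG : GrowthBound ω (derivMean p f')) : GrowthBound ω (derivMean p f) := by
  obtain ⟨M, hM, hb⟩ := hG
  refine ⟨κ * M, by positivity, fun z hz => ?_⟩
  rw [mul_assoc, ENNReal.ofReal_mul hκ.le]
  refine le_trans ?_ (mul_le_mul' le_rfl (hb z hz))
  rw [derivMean_eq_rotNorm, derivMean_eq_rotNorm, ← rotNorm_const_mul hp ENNReal.ofReal_ne_top]
  refine rotNorm_mono fun η => ?_
  rw [← ENNReal.ofReal_mul hκ.le]
  exact ENNReal.ofReal_le_ofReal (hle _ (mul_rot_mem hz η))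

theorem exists_norm_eq_one_mul (w : ℂ) : ∃ c : ℂ, ‖c‖ = 1 ∧ w = ‖w‖ * c := by
  by_cases h : w = 0
  · exact ⟨1, by simp, by simp [h]⟩
  · have : (‖w‖ : ℂ) ≠ 0 := by simpa using h
    exact ⟨w / ‖w‖, by simp [h], (mul_div_cancel₀ w this).symm⟩

namespace HarmonicRep

variable {f h g : ℂ → ℂ} {p : ℝ≥0∞} {ω : ℝ → ℝ}

theorem maxDeriv_eq_norm_deriv (H : HarmonicRep h h 0) {z : ℂ} (hz : z ∈ unitDisk) :
    maxDeriv h z = ‖deriv h z‖ := by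
  simp [H.maxDeriv_eq hz]

theorem growthBound_iff (hp : 1 ≤ p) (hω : IsMajorant ω) (H : HarmonicRep f h g)
    (Hh : HarmonicRep h h 0) (Hg : HarmonicRep g g 0) :
    GrowthBound ω (derivMean p f) ↔
      GrowthBound ω (derivMean p h) ∧ GrowthBound ω (derivMean p g) := by
  constructor
  · intro hG
    constructor
    · refine .of_maxDeriv_le hp one_pos (fun z hz => ?_) hG
      rw [Hh.maxDeriv_eq_norm_deriv hz, H.maxDeriv_eq hz]
      linarith [norm_nonneg (deriv g z)]
    · refine .of_maxDeriv_le hp one_pos (fun z hz => ?_) hG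
      rw [Hg.maxDeriv_eq_norm_deriv hz, H.maxDeriv_eq hz]
      linarith [norm_nonneg (deriv h z)]
  · rintro ⟨⟨M, hM, hb⟩, ⟨M', hM', hb'⟩⟩
    refine ⟨M + M', by positivity, fun z hz => ?_⟩
    have hd := bdryDist_pos hz
    have hω0 := hω.nonneg hd.le
    rw [add_mul, ENNReal.ofReal_add (by positivity) (by positivity)]
    refine le_trans ?_ (add_le_add (hb z hz) (hb' z hz))
    simp only [derivMean_eq_rotNorm, H.maxDeriv_eq (mul_rot_mem hz _),
      Hh.maxDeriv_eq_norm_deriv (mul_rot_mem hz _), Hg.maxDeriv_eq_norm_deriv (mul_rot_mem hz _),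
      ENNReal.ofReal_add (norm_nonneg _) (norm_nonneg _)]
    have hm : Measurable fun η => z * rot η := (continuous_const.mul continuous_rot).measurable
    exact rotNorm_add_le hp ((measurable_deriv h).comp hm).norm.ennreal_ofReal
      ((measurable_deriv g).comp hm).norm.ennreal_ofReal

theorem growthBound_of_modulus_holomorphic (hp : 1 ≤ p) (hω : IsMajorant ω)
    (H : HarmonicRep h h 0) (hL : MemLipschitz ω p (modulus h)) :
    GrowthBound ω (derivMean p h) := by
  refine H.growthBound_of_modulus hp hω one_pos (fun z hz => ?_) hL
  obtain ⟨c, hc, hw⟩ := exists_norm_eq_one_mul (h z)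
  refine ⟨c, hc, hw, ?_⟩
  simp [H.maxDeriv_eq_norm_deriv hz, hc]

/-- A real value has direction `c = ±1`, so the two terms add up to `2 * c * h'`, of modulus `M_f`.
-/
theorem growthBound_of_modulus_real (hp : 1 ≤ p) (hω : IsMajorant ω) (H : HarmonicRep f h h)
    (hreal : ∀ z, ∃ x : ℝ, f z = x) (hL : MemLipschitz ω p (modulus f)) :
    GrowthBound ω (derivMean p f) := by
  refine H.growthBound_of_modulus hp hω one_pos (fun z hz => ?_) hL
  obtain ⟨x, hx⟩ := hreal z
  obtain ⟨c, hc, hcc, hxc⟩ : ∃ c : ℂ, ‖c‖ = 1 ∧ conj c = c ∧ (x : ℂ) = ‖(x : ℂ)‖ * c := by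
    rcases le_total 0 x with h0 | h0
    · exact ⟨1, by simp, by simp, by simp [abs_of_nonneg h0]⟩
    · exact ⟨-1, by simp, by simp, by simp [abs_of_nonpos h0]⟩
  refine ⟨c, hc, hx ▸ hxc, ?_⟩
  rw [H.maxDeriv_eq hz, hcc, ← two_mul, ← two_mul, norm_mul, norm_mul, hc, one_mul, one_mul,
    Complex.norm_ofNat]

/-- The dilatation inequality relates continuous functions here, so it holds everywhere: a violation
would persist on an open set of positive measure. Dividing by `|h'| + |g'|` gives the claim,
trivially so where both derivatives vanish. -/
theorem maxDeriv_le_of_isQuasiregularOn (H : HarmonicRep f h g) {K : ℝ}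
    (hK : IsQuasiregularOn K f unitDisk) {z : ℂ} (hz : z ∈ unitDisk) :
    maxDeriv f z ≤ K * (‖deriv h z‖ - ‖deriv g z‖) := by
  set A : ℂ → ℝ := fun z => ‖deriv h z‖ with hA
  set B : ℂ → ℝ := fun z => ‖deriv g z‖ with hB
  have cA : ContinuousOn A unitDisk := (H.left.deriv isOpen_unitDisk).continuousOn.norm
  have cB : ContinuousOn B unitDisk := (H.right.deriv isOpen_unitDisk).continuousOn.norm
  have hKz : (A z + B z) ^ 2 ≤ K * (A z ^ 2 - B z ^ 2) := by
    by_contra hlt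
    push Not at hlt
    set U := unitDisk ∩ (fun z => (A z + B z) ^ 2 - K * (A z ^ 2 - B z ^ 2)) ⁻¹' Ioi 0 with hU
    have hUo : IsOpen U := ContinuousOn.isOpen_inter_preimage (by fun_prop) isOpen_unitDisk isOpen_Ioi
    have hpos : 0 < volume U := hUo.measure_pos volume ⟨z, hz, by simpa using hlt⟩
    refine hpos.ne' (measure_mono_null ?_
      ((ae_restrict_iff' isOpen_unitDisk.measurableSet).1 hK.dilatation_le))
    rintro w ⟨hw, hw'⟩ hcon
    have := hcon hw
    rw [H.maxDeriv_eq hw, H.jacobian_eq hw] at this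
    simp only [mem_preimage, mem_Ioi, hA, hB] at hw'
    linarith
  rw [H.maxDeriv_eq hz]
  change A z + B z ≤ K * (A z - B z)
  have hA0 : 0 ≤ A z := norm_nonneg _
  have hB0 : 0 ≤ B z := norm_nonneg _
  rcases (add_nonneg hA0 hB0).eq_or_lt with h0 | h0
  · have e1 : A z = 0 := by linarith
    have e2 : B z = 0 := by linarith
    simp [e1, e2]
  · refine le_of_mul_le_mul_right ?_ h0
    linarith [hKz, (by ring : (A z + B z) * (A z + B z) = (A z + B z) ^ 2),
      (by ring : K * (A z - B z) * (A z + B z) = K * (A z ^ 2 - B z ^ 2))]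

/-- For any unimodular `c`, `|conj c * h' + c * g'| ≥ |h'| - |g'| ≥ M_f / K`. -/
theorem growthBound_of_modulus_isQuasiregularOn (hp : 1 ≤ p) (hω : IsMajorant ω)
    (H : HarmonicRep f h g) {K : ℝ} (hK : IsQuasiregularOn K f unitDisk)
    (hL : MemLipschitz ω p (HardyLittlewood.modulus f)) : GrowthBound ω (derivMean p f) := by
  have hK0 : 0 < K := one_pos.trans_le hK.one_le
  refine H.growthBound_of_modulus hp hω hK0 (fun z hz => ?_) hL
  obtain ⟨c, hc, hw⟩ := exists_norm_eq_one_mul (f z)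
  refine ⟨c, hc, hw, (H.maxDeriv_le_of_isQuasiregularOn hK hz).trans ?_⟩
  gcongr
  have := norm_sub_le_norm_add (conj c * deriv h z) (c * deriv g z)
  simpa [hc] using this

end HarmonicRep

end HardyLittlewood

theorem mainTheorem2 (p : ℝ≥0∞) (hp : 1 ≤ p) (ω : ℝ → ℝ) (hω : IsFastMajorant ω)
    (f h g : ℂ → ℂ)
    (hf : HarmonicOnNhd f unitDisk) (hfc : ContinuousOn f closedUnitDisk)
    (hh : DiffContOnCl ℂ h unitDisk) (hg : DiffContOnCl ℂ g unitDisk)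
    (hfhg : ∀ z ∈ unitDisk, f z = h z + conj (g z)) :
    List.TFAE
      [ GrowthBound ω (derivMean p f),
        MemLipschitz ω p f,
        MemLipschitz ω p h ∧ MemLipschitz ω p g,
        MemLipschitz ω p (modulus h) ∧ MemLipschitz ω p (modulus g) ] ∧
    ∀ K : ℝ, 1 ≤ K → IsQuasiregularOn K f unitDisk →
      ∀ q : ℝ, 0 < q → ENNReal.ofReal q ≤ p →
        List.TFAE
          [ GrowthBound ω (derivMean p f),
            MemLipschitz ω p f,
            MemLipschitz ω p h ∧ MemLipschitz ω p g,
            MemLipschitz ω p (modulus h) ∧ MemLipschitz ω p (modulus g),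
            MemLipschitz ω p (modulus f),
            MemLipschitz ω p (rePart f),
            MemLipschitz ω p (modulus (rePart f)),
            MemLipschitz ω p (imPart f),
            MemLipschitz ω p (modulus (imPart f)),
            GrowthBound ω (areaMean q p (rePart f)),
            GrowthBound ω (areaMean q p (imPart f)) ] := by
  have hm := hω.toIsMajorant
  have Hh := HarmonicRep.of_diffContOnCl hh
  have Hg := HarmonicRep.of_diffContOnCl hg
  have H : HarmonicRep f h g := ⟨hfc, Hh.left, Hg.left, hfhg⟩
  have hiff := H.growthBound_iff hp hm Hh Hg
  have t12 : GrowthBound ω (derivMean p f) → MemLipschitz ω p f :=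
    H.memLipschitz_of_growthBound hp hω
  have t21 : MemLipschitz ω p f → GrowthBound ω (derivMean p f) :=
    H.growthBound_of_memLipschitz hp hm
  have t13 : GrowthBound ω (derivMean p f) → MemLipschitz ω p h ∧ MemLipschitz ω p g := fun hG =>
    ⟨Hh.memLipschitz_of_growthBound hp hω (hiff.1 hG).1,
      Hg.memLipschitz_of_growthBound hp hω (hiff.1 hG).2⟩
  have t34 : MemLipschitz ω p h ∧ MemLipschitz ω p g →
      MemLipschitz ω p (modulus h) ∧ MemLipschitz ω p (modulus g) := fun hL =>
    ⟨hL.1.modulus Hh.continuousOn, hL.2.modulus Hg.continuousOn⟩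
  have t41 : MemLipschitz ω p (modulus h) ∧ MemLipschitz ω p (modulus g) →
      GrowthBound ω (derivMean p f) := fun hL =>
    hiff.2 ⟨Hh.growthBound_of_modulus_holomorphic hp hm hL.1,
      Hg.growthBound_of_modulus_holomorphic hp hm hL.2⟩
  refine ⟨?_, fun K _ hK q hq hqp => ?_⟩
  · tfae_have 1 → 2 := t12
    tfae_have 2 → 1 := t21
    tfae_have 1 → 3 := t13
    tfae_have 3 → 4 := t34
    tfae_have 4 → 1 := t41
    tfae_finish
  have hK0 : 0 < K := one_pos.trans_le hK.one_le
  have hre : ∀ z ∈ unitDisk, maxDeriv (rePart f) z = ‖(deriv h + deriv g) z‖ := fun z hz =>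
    H.maxDeriv_re hz
  have him : ∀ z ∈ unitDisk, maxDeriv (imPart f) z = ‖(deriv h - deriv g) z‖ := fun z hz =>
    H.maxDeriv_im hz
  have dh := H.left.deriv isOpen_unitDisk
  have dg := H.right.deriv isOpen_unitDisk
  -- Quasiregularity recovers `M_f` from one real component, since `|h' ± g'| ≥ |h'| - |g'|`.
  have re_f : GrowthBound ω (derivMean p (rePart f)) → GrowthBound ω (derivMean p f) :=
    .of_maxDeriv_le hp hK0 fun z hz => by
      refine (H.maxDeriv_le_of_isQuasiregularOn hK hz).trans ?_
      rw [hre z hz]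
      gcongr
      exact norm_sub_le_norm_add _ _
  have im_f : GrowthBound ω (derivMean p (imPart f)) → GrowthBound ω (derivMean p f) :=
    .of_maxDeriv_le hp hK0 fun z hz => by
      refine (H.maxDeriv_le_of_isQuasiregularOn hK hz).trans ?_
      rw [him z hz]
      gcongr
      exact norm_sub_norm_le _ _
  have f_re : GrowthBound ω (derivMean p f) → GrowthBound ω (derivMean p (rePart f)) :=
    .of_maxDeriv_le hp one_pos fun z hz => by
      rw [hre z hz, H.maxDeriv_eq hz, one_mul]
      exact norm_add_le _ _
  have f_im : GrowthBound ω (derivMean p f) → GrowthBound ω (derivMean p (imPart f)) :=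
    .of_maxDeriv_le hp one_pos fun z hz => by
      rw [him z hz, H.maxDeriv_eq hz, one_mul]
      exact norm_sub_le _ _
  have mre : Measurable (deriv h + deriv g) := (measurable_deriv h).add (measurable_deriv g)
  have mim : Measurable (deriv h - deriv g) := (measurable_deriv h).sub (measurable_deriv g)
  tfae_have 1 → 2 := t12
  tfae_have 2 → 1 := t21
  tfae_have 1 → 3 := t13
  tfae_have 3 → 4 := t34
  tfae_have 4 → 1 := t41
  tfae_have 2 → 5 := fun hL => hL.modulus hfc
  tfae_have 5 → 1 := H.growthBound_of_modulus_isQuasiregularOn hp hm hK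
  tfae_have 2 → 6 := fun hL => hL.of_norm_sub_le H.re.continuousOn (norm_rePart_sub_le f)
  tfae_have 6 → 7 := fun hL => hL.modulus H.re.continuousOn
  tfae_have 7 → 1 := fun hL =>
    re_f (H.re.growthBound_of_modulus_real hp hm (fun z => ⟨_, rfl⟩) hL)
  tfae_have 2 → 8 := fun hL => hL.of_norm_sub_le H.im.continuousOn (norm_imPart_sub_le f)
  tfae_have 8 → 9 := fun hL => hL.modulus H.im.continuousOn
  tfae_have 9 → 1 := fun hL =>
    im_f (H.im.growthBound_of_modulus_real hp hm (fun z => ⟨_, rfl⟩) hL)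
  tfae_have 1 → 10 := fun hG =>
    growthBound_areaMean_of_derivMean mre hre hp hq hqp hm (f_re hG)
  tfae_have 10 → 1 := fun hG =>
    re_f (hG.mono fun z hz => derivMean_le_areaMean mre (dh.add dg) hre p hq hz)
  tfae_have 1 → 11 := fun hG =>
    growthBound_areaMean_of_derivMean mim him hp hq hqp hm (f_im hG)
  tfae_have 11 → 1 := fun hG =>
    im_f (hG.mono fun z hz => derivMean_le_areaMean mim (dh.sub dg) him p hq hz)
  tfae_finish
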